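/- Let $Q=\mathbb R/\mathbb Z$, let $\|\cdot\|_{\rm per}$ denote the distance to $0$ in $Q$, let $1$ denote the Lebesgue measure on $Q$, and for $T>0$ let $Q_T=(-T,T)\times Q$. Let $\mathcal A_T^*$ be the set of measures $\mu=dt\otimes\mu_t$ on $Q_T$ such that, for a.e. $t\in(-T,T)$, $\mu_t=\sum_i\phi_i\delta_{X_i}$ is an (at most countable) sum of Dirac masses with $\phi_i>0$ and $\sum_i\phi_i=1$, and such that there is a finite signed measure $m\ll\mu$ on $Q_T$ with $\partial_t\mu+\partial_x m=0$ in the sense of distributions in $Q_T$. For $\mu\in\mathcal A_T^*$ the curve $t\mapsto\mu_t$ has a weakly continuous representative on $[-T,T]$, which is always the one used and which defines the traces $\mu_{\pm T}$. Set $$I(\mu)=\inf_m\left\{\int_{-T}^{T}\#\{x\in Q:\mu_t(\{x\})>0\}\,dt+\int_{Q_T}\left|\frac{dm}{d\mu}\right|^2d\mu\right\},$$ the infimum being over all finite signed measures $m\ll\mu$ with $\partial_t\mu+\partial_xm=0$ (formally, $I(\mu)=\int_{-T}^T\sum_i[1+\phi_i|\dot X_i|^2]\,dt$). For probability measures $\nu,\nu'$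 on $Q$ let $$W_{\rm per}^2(\nu,\nu')=\inf_\pi\int_{Q\times Q}\|x-y\|_{\rm per}^2\,d\pi(x,y),$$ the infimum being over all couplings $\pi$ of $\nu$ and $\nu'$. For $\lambda>0$ let $$\mathcal E^{\rm 1d}_{\lambda,T}(\mu)=I(\mu)+\lambda\left(W_{\rm per}^2(\mu_T,1)+W_{\rm per}^2(\mu_{-T},1)\right).$$ Theorem. Let $\lambda,T>0$ and let $\mu$ be a minimizer of $\mathcal E^{\rm 1d}_{\lambda,T}$ over $\mathcal A_T^*$ which is symmetric, i.e. $\mu_{-t}=\mu_t$ for every $t\in[0,T]$. Then $\mu_T$ is atomic with finitely many atoms: there are $N\in\mathbb N$, distinct points $X_1,\dots,X_N\in Q$ and $\phi_1,\dots,\phi_N>0$ with $\sum_{i=1}^N\phi_i=1$ such that $\mu_T=\sum_{i=1}^N\phi_i\delta_{X_i}$. -/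

import Mathlib

open MeasureTheory ProbabilityTheory Set Topology
open scoped ENNReal ContDiff

namespace ToyModel

/-- The circle `Q = ℝ / ℤ`. Its norm `‖x‖` is the distance of `x` to the nearest integer, and its
`volume` is the Lebesgue measure, of total mass one (the measure written `1` in the model). -/
abbrev Q : Type := UnitAddCircle

/-- The measure `dt ⊗ μ_t` on the strip `Q_T = (-T, T) × Q`. -/
noncomputable def spaceTime (T : ℝ) (μ : Kernel ℝ Q) : Measure (ℝ × Q) :=
  (volume.restrict (Ioo (-T) T)) ⊗ₘ μ

/-- The time derivative of a function on `ℝ × Q`. -/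
noncomputable def dTime (ξ : ℝ × Q → ℝ) (z : ℝ × Q) : ℝ :=
  deriv (fun s : ℝ => ξ (s, z.2)) z.1

/-- The space derivative of a function on `ℝ × Q`. -/
noncomputable def dSpace (ξ : ℝ × Q → ℝ) (z : ℝ × Q) : ℝ :=
  deriv (fun s : ℝ => ξ (z.1, z.2 + (s : Q))) 0

/-- Smooth functions with compact support in the open strip `(-T, T) × Q`. Smoothness on `ℝ × Q` is
smoothness of the lift to `ℝ × ℝ`. -/
structure IsTestFunction (T : ℝ) (ξ : ℝ × Q → ℝ) : Prop where
  smooth : ContDiff ℝ ∞ (fun p : ℝ × ℝ => ξ (p.1, (p.2 : Q)))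
  compact_support : HasCompactSupport ξ
  support_subset : tsupport ξ ⊆ Ioo (-T) T ×ˢ univ

/-- `m = v μ` is a finite signed measure on `Q_T`, absolutely continuous with respect to `μ`,
with density `dm/dμ = v`, and `∂_t μ + ∂_x m = 0` holds in the sense of distributions in `Q_T`. -/
structure IsVelocity (T : ℝ) (μ : Kernel ℝ Q) (v : ℝ × Q → ℝ) : Prop where
  integrable : Integrable v (spaceTime T μ)
  continuity_eq : ∀ ξ : ℝ × Q → ℝ, IsTestFunction T ξ →
    ∫ z, (dTime ξ z + v z * dSpace ξ z) ∂(spaceTime T μ) = 0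

/-- The admissible `μ = dt ⊗ μ_t` of total flux one. Since the flux `m` is a finite measure that is
absolutely continuous with respect to `μ`, the curve `t ↦ μ_t` has a unique representative which is
weakly continuous on `[-T, T]`. It is this representative that is recorded, so `μ (-T)` and `μ T`
are the traces. The values of `μ` outside `[-T, T]` play no role. -/
structure IsAdmissible (T : ℝ) (μ : Kernel ℝ Q) : Prop where
  prob : IsMarkovKernel μ
  weakly_continuous : ∀ f : C(Q, ℝ), ContinuousOn (fun t => ∫ x, f x ∂(μ t)) (Icc (-T) T)
  atomic : ∀ᵐ t ∂(volume.restrict (Ioo (-T) T)), ∃ (φ : ℕ → ℝ≥0∞) (X : ℕ → Q),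
    μ t = Measure.sum (fun i => φ i • Measure.dirac (X i))
  exists_velocity : ∃ v : ℝ × Q → ℝ, IsVelocity T μ v

/-- The perimeter `∫_{-T}^{T} N(t) dt`, where `N(t)` is the number of points charged by `μ_t`. -/
noncomputable def perimeter (T : ℝ) (μ : Kernel ℝ Q) : ℝ≥0∞ :=
  ∫⁻ t in Ioo (-T) T, (({x : Q | μ t {x} ≠ 0}.encard : ℕ∞) : ℝ≥0∞)

/-- The kinetic energy `∫_{Q_T} |dm/dμ|² dμ` of `m = v μ`. -/
noncomputable def kinetic (T : ℝ) (μ : Kernel ℝ Q) (v : ℝ × Q → ℝ) : ℝ≥0∞ :=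
  ∫⁻ z, ‖v z‖ₑ ^ 2 ∂(spaceTime T μ)

/-- The internal energy `I(μ)`, minimized over the fluxes `m = v μ`. -/
noncomputable def internalEnergy (T : ℝ) (μ : Kernel ℝ Q) : ℝ≥0∞ :=
  ⨅ (v : ℝ × Q → ℝ) (_ : IsVelocity T μ v), (perimeter T μ + kinetic T μ v)

/-- The squared periodic Wasserstein distance between two measures on the circle. -/
noncomputable def wassersteinSq (μ ν : Measure Q) : ℝ≥0∞ :=
  ⨅ (π : Measure (Q × Q)) (_ : π.map Prod.fst = μ ∧ π.map Prod.snd = ν),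
    ∫⁻ p, ‖p.1 - p.2‖ₑ ^ 2 ∂π

/-- The energy `I(μ) + Λ (W²_per(μ_T, 1) + W²_per(μ_{-T}, 1))`. -/
noncomputable def energy (Λ T : ℝ) (μ : Kernel ℝ Q) : ℝ≥0∞ :=
  internalEnergy T μ +
    ENNReal.ofReal Λ * (wassersteinSq (μ T) volume + wassersteinSq (μ (-T)) volume)

/-- Minimizers of the energy among all admissible competitors, symmetric or not. -/
structure IsMinimizer (Λ T : ℝ) (μ : Kernel ℝ Q) : Prop where
  admissible : IsAdmissible T μ
  minimal : ∀ ν : Kernel ℝ Q, IsAdmissible T ν → energy Λ T μ ≤ energy Λ T ν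

/-- Symmetry with respect to the midplane `t = 0`. -/
def IsSymmetric (T : ℝ) (μ : Kernel ℝ Q) : Prop :=
  ∀ t ∈ Icc (0 : ℝ) T, μ (-t) = μ t

end ToyModel

/-!
The idea is to compare the minimizer `μ` with delayed copies of itself. Fix a time `t₀` at which
`μ` has finitely many atoms (almost every time will do, since the perimeter is finite), and let the
competitor follow `μ` up to `t₀`, rest there during a time `ε`, and then follow `μ` again, late by
`ε`. It ends in `μ_{T-ε}`. It pays `ε N(t₀)` for the rest, and it saves the perimeter and the
kinetic energy `K_ε` of `μ` in `(T - ε, T)`.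

The terminal cost grows by little. By Kantorovich duality (`exists_coupling_le_dual`) the difference
`W²(μ_{T-ε}, 1) - W²(μ_T, 1)` is at most the supremum of `∫ φ d(μ_{T-ε} - μ_T)` over `1`-Lipschitz
functions `φ` (`wassersteinSq_le_add`), and by the continuity equation, integrated up to the final
time (`trace_formula`), this is at most the flux `∫_{T-ε}^T ∫ |v| dμ_t dt`. Since
`Λ |v| ≤ |v|² + Λ² / 4`, the saved kinetic energy `K_ε` pays for this flux up to `ε Λ² / 4`.
Minimality therefore gives `∫_{T-ε}^T N(t) dt ≤ C ε` with `C` independent of `ε`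
(`setLIntegral_card_le`).

So there are times `t → T` at which `N(t)` stays bounded. The measures `μ_t` converge weakly to
`μ_T`, and the number of points of the support cannot jump up in the limit (`encard_support_le`).

The trace formula also shows that the delayed curve is admissible, the pieces before, during and
after the rest being glued at their common traces (`isVelocity_delay`).
-/

namespace ToyModel

/-! ### Kantorovich duality on a compact metric space -/

section Duality

variable {X : Type*} [MetricSpace X] [CompactSpace X] [MeasurableSpace X]

/-- The values `∫ φ dν + ∫ ψ dσ` over all continuous `φ`, `ψ` with `f(x, y) ≤ φ(x) + ψ(y)`. -/
def dualValues (ν σ : Measure X) (f : C(X × X, ℝ)) : Set ℝ :=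
  {r | ∃ φ ψ : C(X, ℝ), (∀ x y, f (x, y) ≤ φ x + ψ y) ∧ r = ∫ x, φ x ∂ν + ∫ y, ψ y ∂σ}

lemma continuousMap_integrable {Y : Type*} [TopologicalSpace Y] [CompactSpace Y]
    [MeasurableSpace Y] [OpensMeasurableSpace Y] (ν : Measure Y) [IsFiniteMeasure ν] (f : C(Y, ℝ)) :
    Integrable f ν :=
  (integrable_const ‖f‖).mono' f.continuous.aestronglyMeasurable
    (Filter.Eventually.of_forall fun x => f.norm_coe_le_norm x)

lemma dualValues_nonempty (ν σ : Measure X) (f : C(X × X, ℝ)) : (dualValues ν σ f).Nonempty :=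
  ⟨_, ContinuousMap.const X ‖f‖, 0, fun x y => by
    simpa using (le_abs_self _).trans (f.norm_coe_le_norm (x, y)), rfl⟩

variable [BorelSpace X] (ν σ : Measure X) [IsProbabilityMeasure ν] [IsProbabilityMeasure σ]

lemma le_of_mem_dualValues {f : C(X × X, ℝ)} {r : ℝ} (hr : r ∈ dualValues ν σ f) :
    ∫ z, f z ∂(ν.prod σ) ≤ r := by
  obtain ⟨φ, ψ, h, rfl⟩ := hr
  have h1 : Integrable (fun z : X × X => φ z.1) (ν.prod σ) :=
    continuousMap_integrable _ (φ.comp ⟨Prod.fst, continuous_fst⟩)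
  have h2 : Integrable (fun z : X × X => ψ z.2) (ν.prod σ) :=
    continuousMap_integrable _ (ψ.comp ⟨Prod.snd, continuous_snd⟩)
  have h3 : ∫ z : X × X, φ z.1 ∂(ν.prod σ) = ∫ x, φ x ∂ν := by
    simpa using integral_fun_fst (μ := ν) (ν := σ) (fun x => φ x)
  have h4 : ∫ z : X × X, ψ z.2 ∂(ν.prod σ) = ∫ x, ψ x ∂σ := by
    simpa using integral_fun_snd (μ := ν) (ν := σ) (fun x => ψ x)
  rw [← h3, ← h4, ← integral_add h1 h2]
  exact integral_mono (continuousMap_integrable _ f) (h1.add h2) fun z => h z.1 z.2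

lemma bddBelow_dualValues (f : C(X × X, ℝ)) : BddBelow (dualValues ν σ f) :=
  ⟨_, fun _ hr => le_of_mem_dualValues ν σ hr⟩

lemma sInf_dualValues_add_le (f g : C(X × X, ℝ)) :
    sInf (dualValues ν σ (f + g)) ≤ sInf (dualValues ν σ f) + sInf (dualValues ν σ g) := by
  refine le_of_forall_pos_lt_add fun ε hε => ?_
  obtain ⟨r, ⟨φ, ψ, h, rfl⟩, hr⟩ := exists_lt_of_csInf_lt (dualValues_nonempty ν σ f)
    (lt_add_of_pos_right (sInf (dualValues ν σ f)) (half_pos hε))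
  obtain ⟨r', ⟨φ', ψ', h', rfl⟩, hr'⟩ := exists_lt_of_csInf_lt (dualValues_nonempty ν σ g)
    (lt_add_of_pos_right (sInf (dualValues ν σ g)) (half_pos hε))
  have : sInf (dualValues ν σ (f + g)) ≤
      (∫ x, φ x ∂ν + ∫ x, φ' x ∂ν) + (∫ y, ψ y ∂σ + ∫ y, ψ' y ∂σ) := by
    refine csInf_le (bddBelow_dualValues ν σ _) ⟨φ + φ', ψ + ψ', fun x y => ?_, ?_⟩
    · have := h x y
      have := h' x y
      simp only [ContinuousMap.add_apply]
      linarith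
    · simp only [ContinuousMap.add_apply]
      rw [integral_add (continuousMap_integrable _ _) (continuousMap_integrable _ _),
        integral_add (continuousMap_integrable _ _) (continuousMap_integrable _ _)]
  linarith

lemma sInf_dualValues_smul_le (f : C(X × X, ℝ)) {t : ℝ} (ht : 0 < t) :
    sInf (dualValues ν σ (t • f)) ≤ t * sInf (dualValues ν σ f) := by
  rw [← smul_eq_mul, ← Real.sInf_smul_of_nonneg ht.le]
  refine csInf_le_csInf (bddBelow_dualValues ν σ _) ((dualValues_nonempty ν σ f).smul_set) ?_
  rintro _ ⟨_, ⟨φ, ψ, h, rfl⟩, rfl⟩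
  refine ⟨t • φ, t • ψ, fun x y => ?_, ?_⟩
  · simpa [mul_add] using mul_le_mul_of_nonneg_left (h x y) ht.le
  · simp [integral_const_mul, mul_add]

lemma sInf_dualValues_smul (f : C(X × X, ℝ)) {t : ℝ} (ht : 0 < t) :
    sInf (dualValues ν σ (t • f)) = t * sInf (dualValues ν σ f) := by
  refine le_antisymm (sInf_dualValues_smul_le ν σ f ht) ?_
  have := sInf_dualValues_smul_le ν σ (t • f) (inv_pos.2 ht)
  rw [inv_smul_smul₀ ht.ne'] at this
  calc _ ≤ t * (t⁻¹ * sInf (dualValues ν σ (t • f))) := by gcongr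
    _ = _ := by field_simp

/-- A linear functional below the sublinear functional `f ↦ inf (dualValues ν σ f)` is integration
against a coupling of `ν` and `σ`. -/
lemma exists_coupling_of_le (L : C(X × X, ℝ) →ₗ[ℝ] ℝ)
    (hL : ∀ f, L f ≤ sInf (dualValues ν σ f)) :
    ∃ π : Measure (X × X), (π.map Prod.fst = ν ∧ π.map Prod.snd = σ) ∧ IsFiniteMeasure π ∧
      ∀ f : C(X × X, ℝ), ∫ z, f z ∂π = L f := by
  have hle : ∀ f r, r ∈ dualValues ν σ f → L f ≤ r := fun f r hr =>
    (hL f).trans (csInf_le (bddBelow_dualValues ν σ f) hr)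
  have hpos : ∀ f : C(X × X, ℝ), 0 ≤ f → 0 ≤ L f := by
    intro f hf
    have := hle (-f) 0 ⟨0, 0, fun x y => by simpa using hf (x, y), by simp⟩
    rw [map_neg] at this
    linarith
  have hfst : ∀ φ : C(X, ℝ), L (φ.comp ⟨Prod.fst, continuous_fst⟩) = ∫ x, φ x ∂ν := by
    intro φ
    have h1 := hle (φ.comp ⟨Prod.fst, continuous_fst⟩) (∫ x, φ x ∂ν)
      ⟨φ, 0, fun x y => by simp, by simp⟩
    have h2 := hle (-(φ.comp ⟨Prod.fst, continuous_fst⟩)) (-∫ x, φ x ∂ν)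
      ⟨-φ, 0, fun x y => by simp, by simp [integral_neg]⟩
    rw [map_neg] at h2
    linarith
  have hsnd : ∀ φ : C(X, ℝ), L (φ.comp ⟨Prod.snd, continuous_snd⟩) = ∫ x, φ x ∂σ := by
    intro φ
    have h1 := hle (φ.comp ⟨Prod.snd, continuous_snd⟩) (∫ x, φ x ∂σ)
      ⟨0, φ, fun x y => by simp, by simp⟩
    have h2 := hle (-(φ.comp ⟨Prod.snd, continuous_snd⟩)) (-∫ x, φ x ∂σ)
      ⟨0, -φ, fun x y => by simp, by simp [integral_neg]⟩
    rw [map_neg] at h2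
    linarith
  let Lc : CompactlySupportedContinuousMap (X × X) ℝ →ₚ[ℝ] ℝ := PositiveLinearMap.mk₀
    { toFun := fun f => L f.toContinuousMap
      map_add' := fun f g => L.map_add f.toContinuousMap g.toContinuousMap
      map_smul' := fun t f => L.map_smul t f.toContinuousMap }
    fun f hf => hpos f.toContinuousMap hf
  have hint : ∀ f : C(X × X, ℝ), ∫ z, f z ∂(RealRMK.rieszMeasure Lc) = L f := fun f =>
    RealRMK.integral_rieszMeasure Lc (CompactlySupportedContinuousMap.continuousMapEquiv f)
  have hfin : IsFiniteMeasure (RealRMK.rieszMeasure Lc) := inferInstance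
  refine ⟨RealRMK.rieszMeasure Lc, ⟨?_, ?_⟩, hfin, hint⟩
  · refine ext_of_forall_integral_eq_of_IsFiniteMeasure fun f => ?_
    rw [integral_map measurable_fst.aemeasurable f.continuous.aestronglyMeasurable]
    exact (hint (f.toContinuousMap.comp ⟨Prod.fst, continuous_fst⟩)).trans (hfst f.toContinuousMap)
  · refine ext_of_forall_integral_eq_of_IsFiniteMeasure fun f => ?_
    rw [integral_map measurable_snd.aemeasurable f.continuous.aestronglyMeasurable]
    exact (hint (f.toContinuousMap.comp ⟨Prod.snd, continuous_snd⟩)).trans (hsnd f.toContinuousMap)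

/-- Absence of a duality gap: some coupling has a cost that is at most the supremum of the dual
problem. It comes from extending a linear functional from the line `ℝ c` by Hahn–Banach and
representing the extension as a measure by Riesz–Markov–Kakutani. -/
theorem exists_coupling_le_dual (c : C(X × X, ℝ)) (hc : c ≠ 0) :
    ∃ π : Measure (X × X), (π.map Prod.fst = ν ∧ π.map Prod.snd = σ) ∧ IsFiniteMeasure π ∧
      ∀ δ > 0, ∃ φ ψ : C(X, ℝ), (∀ x y, φ x + ψ y ≤ c (x, y)) ∧
        ∫ z, c z ∂π ≤ ∫ x, φ x ∂ν + ∫ y, ψ y ∂σ + δ := by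
  set p : C(X × X, ℝ) → ℝ := fun f => sInf (dualValues ν σ f) with hp
  have p0 : p 0 = 0 := by
    have := sInf_dualValues_smul ν σ 0 (two_pos)
    rw [smul_zero] at this
    simp only [hp]
    linarith
  -- On the line `ℝ c` the functional is `t (-c) ↦ t p(-c)`; its extension then
  -- attains the dual value at `c`.
  have hdom : ∀ z : (LinearPMap.mkSpanSingleton (K := ℝ) (σ := RingHom.id ℝ) (-c) (p (-c))
      (neg_ne_zero.2 hc)).domain,
      (LinearPMap.mkSpanSingleton (K := ℝ) (σ := RingHom.id ℝ) (-c) (p (-c))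
        (neg_ne_zero.2 hc)) z ≤ p z := by
    rintro ⟨z, hz⟩
    obtain ⟨t, rfl⟩ := Submodule.mem_span_singleton.1 hz
    have : (LinearPMap.mkSpanSingleton (K := ℝ) (σ := RingHom.id ℝ) (-c) (p (-c))
        (neg_ne_zero.2 hc)) ⟨t • (-c), hz⟩ = t * p (-c) :=
      LinearPMap.mkSpanSingleton'_apply _ _ _ _ _
    rw [this]
    rcases lt_trichotomy t 0 with ht | rfl | ht
    · have h1 : p ((-t) • (-c)) = (-t) * p (-c) := sInf_dualValues_smul ν σ _ (neg_pos.2 ht)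
      have h2 : p (t • (-c) + (-t) • (-c)) ≤ p (t • (-c)) + p ((-t) • (-c)) :=
        sInf_dualValues_add_le ν σ _ _
      rw [← add_smul, add_neg_cancel, zero_smul, p0] at h2
      simp only
      linarith
    · simp [p0]
    · exact (sInf_dualValues_smul ν σ _ ht).ge
  obtain ⟨L, hL1, hL2⟩ := exists_extension_of_le_sublinear _ p
    (fun t ht f => sInf_dualValues_smul ν σ f ht) (sInf_dualValues_add_le ν σ) hdom
  have hLc : L (-c) = p (-c) :=
    (hL1 ⟨-c, Submodule.mem_span_singleton_self _⟩).trans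
      (LinearPMap.mkSpanSingleton_apply ℝ ℝ (neg_ne_zero.2 hc) _)
  obtain ⟨π, hπ, hfin, hint⟩ := exists_coupling_of_le ν σ L hL2
  refine ⟨π, hπ, hfin, fun δ hδ => ?_⟩
  obtain ⟨r, ⟨φ, ψ, h, rfl⟩, hr⟩ := exists_lt_of_csInf_lt (dualValues_nonempty ν σ (-c))
    (lt_add_of_pos_right (sInf (dualValues ν σ (-c))) hδ)
  refine ⟨-φ, -ψ, fun x y => ?_, ?_⟩
  · have := h x y
    simp only [ContinuousMap.neg_apply] at this ⊢
    linarith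
  · rw [map_neg] at hLc
    simp only [ContinuousMap.neg_apply, integral_neg, hint]
    simp only [hp] at hLc
    linarith

end Duality

/-! ### Wasserstein distance against Lipschitz test functions -/

/-- The transport cost `‖x - y‖²` as a continuous function. -/
noncomputable def cost : C(Q × Q, ℝ) := ⟨fun p => ‖p.1 - p.2‖ ^ 2, by fun_prop⟩

lemma norm_le_half (x : Q) : ‖x‖ ≤ 1 / 2 := by
  simpa using AddCircle.norm_le_half_period (1 : ℝ) (x := x) one_ne_zero

lemma cost_ne_zero : cost ≠ 0 := by
  intro h
  have h0 : cost (((1 / 2 : ℝ) : Q), 0) = 0 := by rw [h]; rfl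
  have h1 : ‖((1 / 2 : ℝ) : Q)‖ = |1| / 2 := AddCircle.norm_half_period_eq 1
  simp only [cost, ContinuousMap.coe_mk, sub_zero, h1] at h0
  norm_num at h0

lemma lintegral_enorm_sub_sq (π : Measure (Q × Q)) [IsFiniteMeasure π] :
    ∫⁻ p, ‖p.1 - p.2‖ₑ ^ 2 ∂π = ENNReal.ofReal (∫ p, cost p ∂π) := by
  rw [ofReal_integral_eq_lintegral_ofReal (continuousMap_integrable _ _)
    (Filter.Eventually.of_forall fun p => sq_nonneg _)]
  refine lintegral_congr fun p => ?_
  simp only [cost, ContinuousMap.coe_mk]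
  rw [ENNReal.ofReal_pow (norm_nonneg _), ofReal_norm]

/-- The cost is Lipschitz with constant `1` because the circle has diameter `1 / 2`. -/
lemma cost_sub_le (x x' y : Q) : cost (x, y) ≤ cost (x', y) + dist x x' := by
  have h1 := norm_le_half (x - y)
  have h2 := norm_le_half (x' - y)
  have h3 : ‖x - y‖ ≤ ‖x' - y‖ + ‖x - x'‖ := by
    have := norm_add_le (x' - y) (x - x')
    rwa [show x' - y + (x - x') = x - y by abel] at this
  have h4 := norm_nonneg (x' - y)
  have h5 := norm_nonneg (x - y)
  have h6 := norm_nonneg (x - x')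
  rw [dist_eq_norm]
  simp only [cost, ContinuousMap.coe_mk]
  rcases le_total ‖x - y‖ ‖x' - y‖ with h | h <;> nlinarith

/-- The `c`-transform `x ↦ inf_y (‖x - y‖² - ψ(y))`. -/
noncomputable def costTransform (ψ : C(Q, ℝ)) (x : Q) : ℝ := ⨅ y, (cost (x, y) - ψ y)

lemma bddBelow_costTransform (ψ : C(Q, ℝ)) (x : Q) :
    BddBelow (range fun y => cost (x, y) - ψ y) :=
  (isCompact_range (by fun_prop)).bddBelow

lemma costTransform_add_le (ψ : C(Q, ℝ)) (x y : Q) : costTransform ψ x + ψ y ≤ cost (x, y) := by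
  have := ciInf_le (bddBelow_costTransform ψ x) y
  unfold costTransform
  linarith

lemma lipschitzWith_costTransform (ψ : C(Q, ℝ)) : LipschitzWith 1 (costTransform ψ) := by
  refine LipschitzWith.of_le_add fun x x' => ?_
  rw [← sub_le_iff_le_add]
  refine le_ciInf fun y => ?_
  have := costTransform_add_le ψ x y
  have := cost_sub_le x x' y
  linarith

/-- An optimal potential for `ν` may be replaced by a `c`-transform, which is a Lipschitz function;
so the difference of two squared distances to `σ` is bounded by testing with Lipschitz functions. -/
theorem wassersteinSq_le_add (ν μ σ : Measure Q) [IsProbabilityMeasure ν] [IsProbabilityMeasure μ]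
    [IsProbabilityMeasure σ] (B : ℝ)
    (h : ∀ φ : C(Q, ℝ), LipschitzWith 1 φ → ∫ x, φ x ∂ν - ∫ x, φ x ∂μ ≤ B) :
    wassersteinSq ν σ ≤ wassersteinSq μ σ + ENNReal.ofReal B := by
  obtain ⟨π, hπ, hfin, hdual⟩ := exists_coupling_le_dual ν σ cost cost_ne_zero
  refine ENNReal.le_of_forall_pos_le_add fun δ hδ _ => ?_
  obtain ⟨φ, ψ, hφψ, hint⟩ := hdual δ hδ
  let χ : C(Q, ℝ) := ⟨costTransform ψ, (lipschitzWith_costTransform ψ).continuous⟩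
  have hφχ : ∫ x, φ x ∂ν ≤ ∫ x, χ x ∂ν := by
    refine integral_mono (continuousMap_integrable _ _) (continuousMap_integrable _ _) fun x => ?_
    refine le_ciInf fun y => ?_
    have := hφψ x y
    linarith
  have hlip := h χ (lipschitzWith_costTransform ψ)
  have hlow : ENNReal.ofReal (∫ x, χ x ∂μ + ∫ y, ψ y ∂σ) ≤ wassersteinSq μ σ := by
    refine le_iInf₂ fun π' hπ' => ?_
    have : IsProbabilityMeasure π' := by
      have : IsProbabilityMeasure (π'.map Prod.fst) := hπ'.1 ▸ inferInstance
      exact Measure.isProbabilityMeasure_of_map Prod.fst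
    rw [lintegral_enorm_sub_sq]
    refine ENNReal.ofReal_le_ofReal ?_
    rw [← hπ'.1, ← hπ'.2,
      integral_map measurable_fst.aemeasurable χ.continuous.aestronglyMeasurable,
      integral_map measurable_snd.aemeasurable ψ.continuous.aestronglyMeasurable]
    have h1 : Integrable (fun z : Q × Q => χ z.1) π' :=
      continuousMap_integrable _ (χ.comp ⟨Prod.fst, continuous_fst⟩)
    have h2 : Integrable (fun z : Q × Q => ψ z.2) π' :=
      continuousMap_integrable _ (ψ.comp ⟨Prod.snd, continuous_snd⟩)
    rw [← integral_add h1 h2]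
    exact integral_mono (h1.add h2) (continuousMap_integrable _ _)
      fun z => costTransform_add_le ψ z.1 z.2
  calc wassersteinSq ν σ ≤ ∫⁻ p, ‖p.1 - p.2‖ₑ ^ 2 ∂π := iInf₂_le π hπ
    _ = ENNReal.ofReal (∫ p, cost p ∂π) := lintegral_enorm_sub_sq π
    _ ≤ ENNReal.ofReal ((∫ x, χ x ∂μ + ∫ y, ψ y ∂σ) + B + δ) :=
      ENNReal.ofReal_le_ofReal (by linarith)
    _ ≤ ENNReal.ofReal (∫ x, χ x ∂μ + ∫ y, ψ y ∂σ) + ENNReal.ofReal B + ENNReal.ofReal δ :=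
      ENNReal.ofReal_add_le.trans (add_le_add_left ENNReal.ofReal_add_le _)
    _ ≤ wassersteinSq μ σ + ENNReal.ofReal B + δ := by
      rw [ENNReal.ofReal_coe_nnreal]
      gcongr

lemma wassersteinSq_le_one (μ ν : Measure Q) [IsProbabilityMeasure μ] [IsProbabilityMeasure ν] :
    wassersteinSq μ ν ≤ 1 := by
  refine (iInf₂_le (μ.prod ν) ⟨by simp, by simp⟩).trans ?_
  calc ∫⁻ p, ‖p.1 - p.2‖ₑ ^ 2 ∂(μ.prod ν) ≤ ∫⁻ _, 1 ∂(μ.prod ν) := by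
        refine lintegral_mono fun p => pow_le_one' ?_ 2
        rw [← ofReal_norm]
        exact ENNReal.ofReal_le_one.2 ((norm_le_half _).trans (by norm_num))
    _ = 1 := by simp

/-- Mollification on the circle. -/
lemma exists_smooth_approx (φ : C(Q, ℝ)) (hφ : LipschitzWith 1 φ) {δ : ℝ} (hδ : 0 < δ) :
    ∃ ψ : Q → ℝ, ContDiff ℝ ∞ (fun x : ℝ => ψ x) ∧ LipschitzWith 1 (fun x : ℝ => ψ x) ∧
      ∀ x, |ψ x - φ x| ≤ δ := by
  let Φ : ℝ → ℝ := fun x => φ (x : Q)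
  have hcoe : Continuous (fun x : ℝ => (x : Q)) := AddCircle.continuous_mk' 1
  have hΦc : Continuous Φ := φ.continuous.comp hcoe
  have hΦ : ∀ x y, dist (Φ x) (Φ y) ≤ |x - y| := by
    intro x y
    refine (hφ.dist_le_mul _ _).trans ?_
    rw [NNReal.coe_one, one_mul, dist_eq_norm, ← AddCircle.coe_sub]
    exact QuotientAddGroup.norm_mk_le_norm
  let ρ : ContDiffBump (0 : ℝ) := ⟨δ / 2, δ, by positivity, by linarith⟩
  let Ψ : ℝ → ℝ := fun x => ∫ t, ρ.normed volume t * Φ (x - t)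
  have hΨ : Ψ = convolution (ρ.normed volume) Φ (ContinuousLinearMap.lsmul ℝ ℝ) volume := rfl
  have hint : ∀ x, Integrable fun t => ρ.normed volume t * Φ (x - t) := fun x =>
    (ρ.continuous_normed.mul (by fun_prop)).integrable_of_hasCompactSupport
      ρ.hasCompactSupport_normed.mul_right
  have hper : Function.Periodic Ψ 1 := by
    intro x
    refine integral_congr_ae (Filter.Eventually.of_forall fun t => ?_)
    have : ((x + 1 - t : ℝ) : Q) = ((x - t : ℝ) : Q) := by
      rw [show x + 1 - t = (x - t) + 1 by ring, AddCircle.coe_add, AddCircle.coe_period, add_zero]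
    simp only [Φ, this]
  refine ⟨hper.lift, ?_, ?_, ?_⟩
  · have : (fun x : ℝ => hper.lift (x : Q)) = Ψ := funext fun x => hper.lift_coe x
    rw [this, hΨ]
    exact ρ.hasCompactSupport_normed.contDiff_convolution_left _ ρ.contDiff_normed
      hΦc.locallyIntegrable
  · refine LipschitzWith.of_dist_le_mul fun x y => ?_
    rw [NNReal.coe_one, one_mul, hper.lift_coe, hper.lift_coe, dist_eq_norm, ← integral_sub (hint x)
      (hint y)]
    calc _ ≤ ∫ t, ρ.normed volume t * dist x y := by
          refine norm_integral_le_of_norm_le (ρ.integrable_normed.mul_const _)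
            (Filter.Eventually.of_forall fun t => ?_)
          rw [← mul_sub, norm_mul, Real.norm_of_nonneg (ρ.nonneg_normed t)]
          refine mul_le_mul_of_nonneg_left ((hΦ _ _).trans ?_) (ρ.nonneg_normed t)
          rw [sub_sub_sub_cancel_right, Real.dist_eq]
      _ = dist x y := by rw [integral_mul_const, ρ.integral_normed, one_mul]
  · intro x
    induction x using QuotientAddGroup.induction_on with | H x => ?_
    have := ρ.dist_normed_convolution_le (μ := volume) (g := Φ) (x₀ := x) (ε := δ)
      hΦc.aestronglyMeasurable fun y hy => (hΦ y x).trans (Metric.mem_ball.1 hy).le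
    exact this

/-! ### From a weak derivative in time to the fundamental theorem of calculus -/

lemma smoothTransition_deriv_zero {x : ℝ} (hx : x ∉ Icc (0 : ℝ) 1) :
    deriv Real.smoothTransition x = 0 := by
  rw [mem_Icc, not_and_or, not_le, not_le] at hx
  rcases hx with hx | hx
  · have : Real.smoothTransition =ᶠ[𝓝 x] fun _ => 0 := by
      filter_upwards [gt_mem_nhds hx] with y hy using Real.smoothTransition.zero_of_nonpos hy.le
    rw [this.deriv_eq, deriv_const]
  · have : Real.smoothTransition =ᶠ[𝓝 x] fun _ => 1 := by
      filter_upwards [lt_mem_nhds hx] with y hy using Real.smoothTransition.one_of_one_le hy.le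
    rw [this.deriv_eq, deriv_const]

lemma continuous_deriv_smoothTransition : Continuous (deriv Real.smoothTransition) :=
  (Real.smoothTransition.contDiff (n := 1)).continuous_deriv le_rfl

lemma integrable_deriv_smoothTransition : Integrable (deriv Real.smoothTransition) :=
  continuous_deriv_smoothTransition.integrable_of_hasCompactSupport
    (HasCompactSupport.intro isCompact_Icc fun _ hx => smoothTransition_deriv_zero hx)

lemma differentiable_smoothTransition : Differentiable ℝ Real.smoothTransition :=
  (Real.smoothTransition.contDiff (n := 1)).differentiable one_ne_zero

lemma integral_deriv_smoothTransition : ∫ x, deriv Real.smoothTransition x = 1 := by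
  have := integral_of_hasDerivAt_of_tendsto (m := 0) (n := 1)
    (fun x => (differentiable_smoothTransition x).hasDerivAt)
    integrable_deriv_smoothTransition
    (tendsto_const_nhds.congr' (by
      filter_upwards [Filter.eventually_le_atBot 0] with x hx
        using (Real.smoothTransition.zero_of_nonpos hx).symm))
    (tendsto_const_nhds.congr' (by
      filter_upwards [Filter.eventually_ge_atTop 1] with x hx
        using (Real.smoothTransition.one_of_one_le hx).symm))
  simpa using this

/-- The derivatives of steeper and steeper smooth steps located near `a` converge to `δ_a`. -/
lemma tendsto_integral_steep {h : ℝ → ℝ} (hc : Continuous h) {C : ℝ} (hC : ∀ x, ‖h x‖ ≤ C)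
    {N c : ℕ → ℝ} {a : ℝ} (hN : ∀ n, 0 < N n) (hN' : Filter.Tendsto N Filter.atTop Filter.atTop)
    (hc' : Filter.Tendsto (fun n => c n / N n) Filter.atTop (𝓝 a)) :
    Filter.Tendsto
      (fun n => ∫ t, N n * deriv Real.smoothTransition (N n * t - c n) * h t) Filter.atTop
      (𝓝 (h a)) := by
  have key : ∀ n, ∫ t, N n * deriv Real.smoothTransition (N n * t - c n) * h t =
      ∫ u, deriv Real.smoothTransition u * h ((u + c n) / N n) := by
    intro n
    have h1 := Measure.integral_comp_mul_left
      (fun y => deriv Real.smoothTransition (y - c n) * h (y / N n)) (N n)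
    have h2 := integral_sub_right_eq_self (μ := volume)
      (fun u => deriv Real.smoothTransition u * h ((u + c n) / N n)) (c n)
    simp only [mul_div_cancel_left₀ _ (hN n).ne', smul_eq_mul, abs_of_pos (inv_pos.2 (hN n))] at h1
    simp only [sub_add_cancel] at h2
    rw [← h2]
    simp only [mul_assoc]
    rw [integral_const_mul, h1, mul_inv_cancel_left₀ (hN n).ne']
  simp_rw [key]
  have : h a = ∫ u, deriv Real.smoothTransition u * h a := by
    rw [integral_mul_const, integral_deriv_smoothTransition, one_mul]
  rw [this]
  refine tendsto_integral_of_dominated_convergence (fun u => ‖deriv Real.smoothTransition u‖ * C)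
    (fun n => ?_) (integrable_deriv_smoothTransition.norm.mul_const C)
    (fun n => Filter.Eventually.of_forall fun u => ?_)
    (Filter.Eventually.of_forall fun u => ?_)
  · exact (continuous_deriv_smoothTransition.mul
      (hc.comp (by fun_prop))).aestronglyMeasurable
  · rw [norm_mul]
    exact mul_le_mul_of_nonneg_left (hC _) (norm_nonneg _)
  · refine Filter.Tendsto.const_mul _ ((hc.tendsto a).comp ?_)
    have : Filter.Tendsto (fun n => u / N n + c n / N n) Filter.atTop (𝓝 (0 + a)) :=
      (tendsto_const_nhds.div_atTop hN').add hc'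
    rw [zero_add] at this
    simpa only [add_div] using this

/-- If `g` is the weak derivative of the continuous function `h`, then `∫_a^b g = h(b) - h(a)`,
up to and including the ends of the interval. -/
theorem integral_eq_sub_of_weak_deriv {T : ℝ} {h g : ℝ → ℝ} (hc : ContinuousOn h (Icc (-T) T))
    (hg : IntegrableOn g (Ioo (-T) T))
    (hw : ∀ η : ℝ → ℝ, ContDiff ℝ ∞ η → tsupport η ⊆ Ioo (-T) T →
      (∫ t in Ioo (-T) T, deriv η t * h t) + ∫ t in Ioo (-T) T, η t * g t = 0)
    {a b : ℝ} (ha : -T ≤ a) (hab : a < b) (hb : b ≤ T) :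
    ∫ t in Ioo a b, g t = h b - h a := by
  have hT : -T ≤ T := by linarith
  let k : ℝ → ℝ := IccExtend hT ((Icc (-T) T).domRestrict h)
  have hk : Continuous k := hc.domRestrict.Icc_extend'
  have hkh : ∀ t ∈ Icc (-T) T, k t = h t := fun t ht => IccExtend_of_mem hT _ ht
  obtain ⟨C, hC⟩ : ∃ C, ∀ x, ‖k x‖ ≤ C := by
    obtain ⟨C, hC⟩ := isCompact_Icc.exists_bound_of_continuousOn hc
    exact ⟨C, fun x => hC _ (projIcc (-T) T hT x).2⟩
  -- The slope `N n` is so large that the upward step at `a` is over before the downward step at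
  -- `b` starts; both steps lie strictly inside `(a, b)`.
  let N : ℕ → ℝ := fun n => n + 4 / (b - a)
  have hba : 0 < b - a := sub_pos.2 hab
  have hN : ∀ n, 0 < N n := fun n => by positivity
  have hNab : ∀ n, 4 ≤ N n * (b - a) := fun n => by
    have : N n * (b - a) = n * (b - a) + 4 := by simp only [N]; field_simp
    rw [this]
    have : 0 ≤ (n : ℝ) * (b - a) := by positivity
    linarith
  have hN' : Filter.Tendsto N Filter.atTop Filter.atTop :=
    Filter.tendsto_atTop_add_const_right _ _ tendsto_natCast_atTop_atTop
  let c : ℕ → ℝ := fun n => N n * a + 1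
  let d : ℕ → ℝ := fun n => N n * b - 2
  let η : ℕ → ℝ → ℝ := fun n t =>
    Real.smoothTransition (N n * t - c n) - Real.smoothTransition (N n * t - d n)
  have hηs : ∀ n, ContDiff ℝ ∞ (η n) := fun n =>
    (Real.smoothTransition.contDiff.comp (by fun_prop)).sub
      (Real.smoothTransition.contDiff.comp (by fun_prop))
  have hderiv : ∀ n t, deriv (η n) t = N n * deriv Real.smoothTransition (N n * t - c n) -
      N n * deriv Real.smoothTransition (N n * t - d n) := by
    intro n t
    have aux : ∀ e : ℝ, HasDerivAt (fun s => Real.smoothTransition (N n * s - e))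
        (N n * deriv Real.smoothTransition (N n * t - e)) t := by
      intro e
      have := (differentiable_smoothTransition (N n * t - e)).hasDerivAt.comp t
        (((hasDerivAt_id t).const_mul (N n)).sub_const e)
      rwa [mul_one, mul_comm] at this
    exact ((aux _).sub (aux _)).deriv
  have hη0 : ∀ n t, t ∉ Icc (a + 1 / N n) (b - 1 / N n) → η n t = 0 := by
    intro n t ht
    have h4 := hNab n
    rw [mem_Icc, not_and_or, not_le, not_le] at ht
    rcases ht with ht | ht
    · have h1 : N n * t < N n * a + 1 := by
        have := mul_lt_mul_of_pos_left ht (hN n)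
        rwa [mul_add, mul_one_div_cancel (hN n).ne'] at this
      simp only [η, c, d]
      rw [Real.smoothTransition.zero_of_nonpos, Real.smoothTransition.zero_of_nonpos, sub_zero] <;>
        linarith
    · have h1 : N n * b - 1 < N n * t := by
        have := mul_lt_mul_of_pos_left ht (hN n)
        rwa [mul_sub, mul_one_div_cancel (hN n).ne'] at this
      simp only [η, c, d]
      rw [Real.smoothTransition.one_of_one_le, Real.smoothTransition.one_of_one_le, sub_self] <;>
        linarith
  have hsub : ∀ n, tsupport (η n) ⊆ Ioo (-T) T := by
    intro n
    have h1 : tsupport (η n) ⊆ Icc (a + 1 / N n) (b - 1 / N n) :=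
      closure_minimal (fun t ht => by by_contra h; exact ht (hη0 n t h)) isClosed_Icc
    have h2 : 0 < 1 / N n := one_div_pos.2 (hN n)
    exact h1.trans fun t ht => ⟨by linarith [ht.1], by linarith [ht.2]⟩
  have hca : Filter.Tendsto (fun n => c n / N n) Filter.atTop (𝓝 a) := by
    have : Filter.Tendsto (fun n => a + 1 / N n) Filter.atTop (𝓝 (a + 0)) :=
      tendsto_const_nhds.add (tendsto_const_nhds.div_atTop hN')
    rw [add_zero] at this
    refine this.congr fun n => ?_
    have := (hN n).ne'
    simp only [c]
    field_simp
  have hdb : Filter.Tendsto (fun n => d n / N n) Filter.atTop (𝓝 b) := by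
    have : Filter.Tendsto (fun n => b - 2 / N n) Filter.atTop (𝓝 (b - 0)) :=
      tendsto_const_nhds.sub (tendsto_const_nhds.div_atTop hN')
    rw [sub_zero] at this
    refine this.congr fun n => ?_
    have := (hN n).ne'
    simp only [d]
    field_simp
  have hint : ∀ n (e : ℝ), Integrable fun t =>
      N n * deriv Real.smoothTransition (N n * t - e) * k t := by
    intro n e
    refine Integrable.mul_bdd (c := C) ?_ hk.aestronglyMeasurable
      (Filter.Eventually.of_forall hC)
    have := ((integrable_deriv_smoothTransition.comp_sub_right e).comp_mul_left' (hN n).ne')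
    exact this.const_mul _
  have hlim1 : Filter.Tendsto (fun n => ∫ t in Ioo (-T) T, deriv (η n) t * h t) Filter.atTop
      (𝓝 (h a - h b)) := by
    have h1 : ∀ n, ∫ t in Ioo (-T) T, deriv (η n) t * h t =
        (∫ t, N n * deriv Real.smoothTransition (N n * t - c n) * k t) -
          ∫ t, N n * deriv Real.smoothTransition (N n * t - d n) * k t := by
      intro n
      rw [← integral_sub (hint n _) (hint n _)]
      have : ∀ t ∈ Ioo (-T) T, deriv (η n) t * h t = deriv (η n) t * k t := fun t ht => by
        rw [hkh t (Ioo_subset_Icc_self ht)]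
      rw [setIntegral_congr_fun measurableSet_Ioo this,
        setIntegral_eq_integral_of_forall_compl_eq_zero]
      · refine integral_congr_ae (Filter.Eventually.of_forall fun t => ?_)
        simp only [hderiv, sub_mul]
      · intro t ht
        have : t ∉ tsupport (deriv (η n)) := fun h => ht (hsub n (tsupport_deriv_subset h))
        rw [image_eq_zero_of_notMem_tsupport this, zero_mul]
    simp_rw [h1]
    rw [← hkh a ⟨ha, by linarith⟩, ← hkh b ⟨by linarith, hb⟩]
    exact (tendsto_integral_steep hk hC hN hN' hca).sub (tendsto_integral_steep hk hC hN hN' hdb)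
  have hlim2 : Filter.Tendsto (fun n => ∫ t in Ioo (-T) T, η n t * g t) Filter.atTop
      (𝓝 (∫ t in Ioo a b, g t)) := by
    have h1 : ∫ t in Ioo a b, g t = ∫ t in Ioo (-T) T, (Ioo a b).indicator g t := by
      rw [setIntegral_indicator measurableSet_Ioo,
        inter_eq_self_of_subset_right (Ioo_subset_Ioo ha hb)]
    rw [h1]
    refine tendsto_integral_of_dominated_convergence (fun t => ‖g t‖) (fun n => ?_) hg.norm
      (fun n => Filter.Eventually.of_forall fun t => ?_) (Filter.Eventually.of_forall fun t => ?_)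
    · exact (hηs n).continuous.aestronglyMeasurable.mul hg.aestronglyMeasurable
    · rw [norm_mul]
      refine mul_le_of_le_one_left (norm_nonneg _) ?_
      have h1 := Real.smoothTransition.nonneg (N n * t - c n)
      have h2 := Real.smoothTransition.le_one (N n * t - c n)
      have h3 := Real.smoothTransition.nonneg (N n * t - d n)
      have h4 := Real.smoothTransition.le_one (N n * t - d n)
      rw [Real.norm_eq_abs, abs_le]
      constructor <;> simp only [η] <;> linarith
    · by_cases ht : t ∈ Ioo a b
      · rw [indicator_of_mem ht]
        have e1 : ∀ᶠ n in Filter.atTop, 2 ≤ N n * (t - a) :=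
          (hN'.atTop_mul_const (sub_pos.2 ht.1)).eventually_ge_atTop 2
        have e2 : ∀ᶠ n in Filter.atTop, 2 ≤ N n * (b - t) :=
          (hN'.atTop_mul_const (sub_pos.2 ht.2)).eventually_ge_atTop 2
        refine tendsto_const_nhds.congr' ?_
        filter_upwards [e1, e2] with n h1 h2
        simp only [η, c, d]
        rw [Real.smoothTransition.one_of_one_le (by linarith),
          Real.smoothTransition.zero_of_nonpos (by linarith), sub_zero, one_mul]
      · rw [indicator_of_notMem ht]
        refine tendsto_const_nhds.congr fun n => ?_
        rw [hη0 n t, zero_mul]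
        intro h'
        have h2 : 0 < 1 / N n := one_div_pos.2 (hN n)
        exact ht ⟨by linarith [h'.1], by linarith [h'.2]⟩
  have := tendsto_nhds_unique ((hlim1.add hlim2).congr fun n => hw (η n) (hηs n) (hsub n))
    tendsto_const_nhds
  linarith

/-! ### Smooth functions on the cylinder -/

/-- Smoothness of a function on `ℝ × Q`, expressed through its lift to `ℝ × ℝ`. -/
def SmoothLift (ξ : ℝ × Q → ℝ) : Prop := ContDiff ℝ ∞ (fun p : ℝ × ℝ => ξ (p.1, (p.2 : Q)))

lemma continuous_of_lift {F : ℝ × Q → ℝ} (hF : Continuous fun p : ℝ × ℝ => F (p.1, (p.2 : Q))) :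
    Continuous F := by
  have hq : IsOpenQuotientMap (Prod.map (id : ℝ → ℝ) (fun x : ℝ => (x : Q))) :=
    IsOpenQuotientMap.id.prodMap QuotientAddGroup.isOpenQuotientMap_mk
  exact hq.isQuotientMap.continuous_iff.2 hF

namespace SmoothLift

variable {ξ : ℝ × Q → ℝ}

lemma continuous (hξ : SmoothLift ξ) : Continuous ξ := continuous_of_lift (ContDiff.continuous hξ)

lemma hasDerivAt_time (hξ : SmoothLift ξ) (t x : ℝ) : HasDerivAt (fun s => ξ (s, (x : Q)))
    (fderiv ℝ (fun p : ℝ × ℝ => ξ (p.1, (p.2 : Q))) (t, x) (1, 0)) t := by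
  have h1 : HasFDerivAt (fun p : ℝ × ℝ => ξ (p.1, (p.2 : Q)))
      (fderiv ℝ (fun p : ℝ × ℝ => ξ (p.1, (p.2 : Q))) (t, x)) (t, x) :=
    ((ContDiff.differentiable hξ (by simp)) (t, x)).hasFDerivAt
  exact h1.comp_hasDerivAt t ((hasDerivAt_id t).prodMk (hasDerivAt_const t x))

lemma dTime_eq (hξ : SmoothLift ξ) (t x : ℝ) : dTime ξ (t, (x : Q)) =
    fderiv ℝ (fun p : ℝ × ℝ => ξ (p.1, (p.2 : Q))) (t, x) (1, 0) :=
  (hξ.hasDerivAt_time t x).deriv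

lemma hasDerivAt_dTime (hξ : SmoothLift ξ) (t : ℝ) (x : Q) :
    HasDerivAt (fun s => ξ (s, x)) (dTime ξ (t, x)) t := by
  induction x using QuotientAddGroup.induction_on with | H x => ?_
  have := hξ.hasDerivAt_time t x
  rwa [← hξ.dTime_eq] at this

lemma hasDerivAt_dSpace_zero (hξ : SmoothLift ξ) (t x : ℝ) :
    HasDerivAt (fun s : ℝ => ξ (t, (x : Q) + (s : Q)))
    (fderiv ℝ (fun p : ℝ × ℝ => ξ (p.1, (p.2 : Q))) (t, x) (0, 1)) 0 := by
  have h1 : HasFDerivAt (fun p : ℝ × ℝ => ξ (p.1, (p.2 : Q)))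
      (fderiv ℝ (fun p : ℝ × ℝ => ξ (p.1, (p.2 : Q))) (t, x)) (t, x + 0) := by
    rw [add_zero]
    exact ((ContDiff.differentiable hξ (by simp)) (t, x)).hasFDerivAt
  exact h1.comp_hasDerivAt (0 : ℝ) ((hasDerivAt_const 0 t).prodMk ((hasDerivAt_id 0).const_add x))

lemma dSpace_eq (hξ : SmoothLift ξ) (t x : ℝ) : dSpace ξ (t, (x : Q)) =
    fderiv ℝ (fun p : ℝ × ℝ => ξ (p.1, (p.2 : Q))) (t, x) (0, 1) :=
  (hξ.hasDerivAt_dSpace_zero t x).deriv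

lemma hasDerivAt_dSpace (hξ : SmoothLift ξ) (t : ℝ) (x : Q) :
    HasDerivAt (fun s : ℝ => ξ (t, x + (s : Q))) (dSpace ξ (t, x)) 0 := by
  induction x using QuotientAddGroup.induction_on with | H x => ?_
  have := hξ.hasDerivAt_dSpace_zero t x
  rwa [← hξ.dSpace_eq] at this

lemma continuous_dTime (hξ : SmoothLift ξ) : Continuous (dTime ξ) := by
  refine continuous_of_lift ?_
  simp only [hξ.dTime_eq]
  exact (ContDiff.continuous_fderiv hξ (by simp)).clm_apply continuous_const

lemma continuous_dSpace (hξ : SmoothLift ξ) : Continuous (dSpace ξ) := by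
  refine continuous_of_lift ?_
  simp only [hξ.dSpace_eq]
  exact (ContDiff.continuous_fderiv hξ (by simp)).clm_apply continuous_const

lemma time_mul (hξ : SmoothLift ξ) {η : ℝ → ℝ} (hη : ContDiff ℝ ∞ η) :
    SmoothLift fun z => η z.1 * ξ z :=
  (hη.comp contDiff_fst).mul hξ

lemma dTime_time_mul (hξ : SmoothLift ξ) {η : ℝ → ℝ} (hη : ContDiff ℝ ∞ η) (z : ℝ × Q) :
    dTime (fun z => η z.1 * ξ z) z = deriv η z.1 * ξ z + η z.1 * dTime ξ z :=
  (((hη.differentiable (by simp)) z.1).hasDerivAt.mul (hξ.hasDerivAt_dTime z.1 z.2)).deriv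

lemma dSpace_time_mul (hξ : SmoothLift ξ) (η : ℝ → ℝ) (z : ℝ × Q) :
    dSpace (fun z => η z.1 * ξ z) z = η z.1 * dSpace ξ z :=
  ((hξ.hasDerivAt_dSpace z.1 z.2).const_mul (η z.1)).deriv

lemma time_shift (hξ : SmoothLift ξ) (ε : ℝ) : SmoothLift fun z => ξ (z.1 + ε, z.2) :=
  ContDiff.comp (g := fun p : ℝ × ℝ => ξ (p.1, (p.2 : Q))) (f := fun p : ℝ × ℝ => (p.1 + ε, p.2))
    hξ (by fun_prop)

lemma dTime_time_shift (hξ : SmoothLift ξ) (ε : ℝ) (z : ℝ × Q) :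
    dTime (fun z => ξ (z.1 + ε, z.2)) z = dTime ξ (z.1 + ε, z.2) :=
  ((hξ.hasDerivAt_dTime (z.1 + ε) z.2).comp_add_const z.1 ε).deriv

lemma dSpace_time_shift (ξ : ℝ × Q → ℝ) (ε : ℝ) (z : ℝ × Q) :
    dSpace (fun z => ξ (z.1 + ε, z.2)) z = dSpace ξ (z.1 + ε, z.2) := rfl

end SmoothLift

/-! ### The trace formula for the continuity equation -/

section Trace

variable {T : ℝ} {μ : Kernel ℝ Q} [IsMarkovKernel μ]

instance : IsFiniteMeasure (spaceTime T μ) := by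
  unfold spaceTime
  infer_instance

lemma ae_spaceTime_mem : ∀ᵐ z ∂(spaceTime T μ), z.1 ∈ Ioo (-T) T := by
  refine ae_of_ae_map (f := Prod.fst) measurable_fst.aemeasurable ?_
  have : (spaceTime T μ).map Prod.fst = volume.restrict (Ioo (-T) T) :=
    Measure.fst_compProd _ _
  rw [this]
  exact ae_restrict_mem measurableSet_Ioo

lemma exists_ae_bound {F : ℝ × Q → ℝ} (hF : Continuous F) :
    ∃ C, ∀ᵐ z ∂(spaceTime T μ), ‖F z‖ ≤ C := by
  obtain ⟨C, hC⟩ := ((isCompact_Icc (a := -T) (b := T)).prod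
    (isCompact_univ (X := Q))).exists_bound_of_continuousOn hF.continuousOn
  refine ⟨C, ?_⟩
  filter_upwards [ae_spaceTime_mem] with z hz
  exact hC z ⟨Ioo_subset_Icc_self hz, mem_univ _⟩

lemma integrable_spaceTime_of_continuous {F : ℝ × Q → ℝ} (hF : Continuous F) :
    Integrable F (spaceTime T μ) := by
  obtain ⟨C, hC⟩ := exists_ae_bound (T := T) (μ := μ) hF
  exact (integrable_const C).mono' hF.aestronglyMeasurable hC

lemma integrable_transport {v : ℝ × Q → ℝ} (hv : Integrable v (spaceTime T μ)) {ξ : ℝ × Q → ℝ}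
    (hξ : SmoothLift ξ) :
    Integrable (fun z => dTime ξ z + v z * dSpace ξ z) (spaceTime T μ) := by
  obtain ⟨C, hC⟩ := exists_ae_bound (T := T) (μ := μ) hξ.continuous_dSpace
  exact (integrable_spaceTime_of_continuous hξ.continuous_dTime).add
    (hv.mul_bdd hξ.continuous_dSpace.aestronglyMeasurable hC)

lemma integrable_slice_integral {F : ℝ × Q → ℝ} (hF : Integrable F (spaceTime T μ)) :
    IntegrableOn (fun t => ∫ x, F (t, x) ∂(μ t)) (Ioo (-T) T) :=
  Integrable.integral_compProd hF

lemma integral_spaceTime {F : ℝ × Q → ℝ} (hF : Integrable F (spaceTime T μ)) :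
    ∫ z, F z ∂(spaceTime T μ) = ∫ t in Ioo (-T) T, ∫ x, F (t, x) ∂(μ t) :=
  Measure.integral_compProd hF

lemma continuousOn_slice_integral
    (hw : ∀ f : C(Q, ℝ), ContinuousOn (fun t => ∫ x, f x ∂(μ t)) (Icc (-T) T))
    {ξ : ℝ × Q → ℝ} (hξ : Continuous ξ) :
    ContinuousOn (fun t => ∫ x, ξ (t, x) ∂(μ t)) (Icc (-T) T) := by
  intro s hs
  let F : C(ℝ, C(Q, ℝ)) := (⟨ξ, hξ⟩ : C(ℝ × Q, ℝ)).curry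
  have hF : ∀ t x, F t x = ξ (t, x) := fun t x => rfl
  have h1 : Filter.Tendsto (fun t => ∫ x, F s x ∂(μ t)) (𝓝[Icc (-T) T] s)
      (𝓝 (∫ x, F s x ∂(μ s))) := hw (F s) s hs
  have h2 : Filter.Tendsto (fun t => ∫ x, (F t - F s) x ∂(μ t)) (𝓝[Icc (-T) T] s) (𝓝 0) := by
    refine squeeze_zero_norm (a := fun t => ‖F t - F s‖) (fun t => ?_) ?_
    · refine (norm_integral_le_of_norm_le (integrable_const ‖F t - F s‖)
        (Filter.Eventually.of_forall fun x => (F t - F s).norm_coe_le_norm x)).trans ?_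
      simp
    · have : Continuous fun t => ‖F t - F s‖ := (F.continuous.sub continuous_const).norm
      have := this.tendsto s
      rw [sub_self, norm_zero] at this
      exact this.mono_left nhdsWithin_le_nhds
  have h3 := h1.add h2
  rw [add_zero] at h3
  refine h3.congr fun t => ?_
  rw [← integral_add (continuousMap_integrable _ _) (continuousMap_integrable _ _)]
  simp [hF]

/-- The continuity equation, integrated over `(a, b) × Q` against a function that need not vanish
at the times `a` and `b`. -/
theorem trace_formula {v : ℝ × Q → ℝ} (hv : IsVelocity T μ v)
    (hw : ∀ f : C(Q, ℝ), ContinuousOn (fun t => ∫ x, f x ∂(μ t)) (Icc (-T) T))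
    {ξ : ℝ × Q → ℝ} (hξ : SmoothLift ξ) {a b : ℝ} (ha : -T ≤ a) (hab : a < b) (hb : b ≤ T) :
    ∫ t in Ioo a b, ∫ x, (dTime ξ (t, x) + v (t, x) * dSpace ξ (t, x)) ∂(μ t) =
      ∫ x, ξ (b, x) ∂(μ b) - ∫ x, ξ (a, x) ∂(μ a) := by
  have hG := integrable_transport hv.integrable hξ
  refine integral_eq_sub_of_weak_deriv (continuousOn_slice_integral hw hξ.continuous)
    (integrable_slice_integral hG) (fun η hη hsub => ?_) ha hab hb
  have hηc : HasCompactSupport η :=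
    isCompact_Icc.of_isClosed_subset (isClosed_tsupport η) (hsub.trans Ioo_subset_Icc_self)
  have hts : tsupport (fun z : ℝ × Q => η z.1 * ξ z) ⊆ tsupport η ×ˢ univ := by
    refine closure_minimal (fun z hz => ⟨subset_tsupport η fun h => hz ?_, mem_univ _⟩)
      ((isClosed_tsupport η).prod isClosed_univ)
    simp [h]
  have htest : IsTestFunction T fun z => η z.1 * ξ z :=
    ⟨hξ.time_mul hη, (hηc.isCompact.prod isCompact_univ).of_isClosed_subset
      (isClosed_tsupport _) hts, hts.trans (prod_mono hsub Subset.rfl)⟩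
  have h0 := hv.continuity_eq _ htest
  have hd : Continuous (deriv η) := hη.continuous_deriv (by simp)
  have i1 : Integrable (fun z : ℝ × Q => deriv η z.1 * ξ z) (spaceTime T μ) :=
    integrable_spaceTime_of_continuous ((hd.comp continuous_fst).mul hξ.continuous)
  have i2 : Integrable (fun z : ℝ × Q => η z.1 * (dTime ξ z + v z * dSpace ξ z))
      (spaceTime T μ) := by
    have hc : Continuous fun z : ℝ × Q => η z.1 := hη.continuous.comp continuous_fst
    obtain ⟨C, hC⟩ := exists_ae_bound (T := T) (μ := μ) hc
    exact hG.bdd_mul hc.aestronglyMeasurable hC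
  have h1 : ∫ z, deriv η z.1 * ξ z ∂(spaceTime T μ) +
      ∫ z, η z.1 * (dTime ξ z + v z * dSpace ξ z) ∂(spaceTime T μ) = 0 := by
    rw [← integral_add i1 i2, ← h0]
    refine integral_congr_ae (Filter.Eventually.of_forall fun z => ?_)
    simp only [hξ.dTime_time_mul hη, hξ.dSpace_time_mul η]
    ring
  rw [integral_spaceTime i1, integral_spaceTime i2] at h1
  simpa only [integral_const_mul] using h1

end Trace

/-! ### Constant curves -/

lemma IsTestFunction.eq_zero {T : ℝ} {ξ : ℝ × Q → ℝ} (hξ : IsTestFunction T ξ) {t : ℝ}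
    (ht : t ∉ Ioo (-T) T) (x : Q) : ξ (t, x) = 0 :=
  image_eq_zero_of_notMem_tsupport fun h => ht (hξ.support_subset h).1

lemma setIntegral_Ioo_deriv {f f' : ℝ → ℝ} {a b : ℝ} (hab : a ≤ b)
    (hf : ∀ t, HasDerivAt f (f' t) t) (hc : Continuous f') :
    ∫ t in Ioo a b, f' t = f b - f a := by
  rw [← integral_Ioc_eq_integral_Ioo, ← intervalIntegral.integral_of_le hab]
  exact intervalIntegral.integral_eq_sub_of_hasDerivAt (fun t _ => hf t) (hc.intervalIntegrable a b)

/-- A curve that does not move is transported by the velocity zero. -/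
lemma isVelocity_const {T : ℝ} (hT : 0 ≤ T) (ρ : Measure Q) [IsProbabilityMeasure ρ] :
    IsVelocity T (Kernel.const ℝ ρ) 0 := by
  refine ⟨integrable_zero _ _ _, fun ξ hξ => ?_⟩
  have hs : SmoothLift ξ := hξ.smooth
  have hi := integrable_spaceTime_of_continuous (T := T) (μ := Kernel.const ℝ ρ) hs.continuous_dTime
  simp only [Pi.zero_apply, zero_mul, add_zero]
  unfold spaceTime at hi ⊢
  rw [Measure.compProd_const] at hi ⊢
  rw [integral_prod_symm _ hi]
  refine integral_eq_zero_of_ae (Filter.Eventually.of_forall fun x => ?_)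
  have hd := setIntegral_Ioo_deriv (a := -T) (b := T) (by linarith)
    (fun t => hs.hasDerivAt_dTime t x) (hs.continuous_dTime.comp (by fun_prop))
  simp only [Pi.zero_apply]
  rw [hd, hξ.eq_zero (by simp), hξ.eq_zero (by simp), sub_zero]

/-! ### Delayed curves -/

/-- The clock that runs until `t₀`, stops for a time `ε`, and then resumes. -/
def delay (t₀ ε t : ℝ) : ℝ := max (min t t₀) (t - ε)

lemma continuous_delay (t₀ ε : ℝ) : Continuous (delay t₀ ε) := by
  unfold delay
  fun_prop

lemma delay_of_le {t₀ ε t : ℝ} (hε : 0 < ε) (ht : t ≤ t₀) : delay t₀ ε t = t := by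
  rw [delay, min_eq_left ht, max_eq_left (by linarith)]

lemma delay_of_mem {t₀ ε t : ℝ} (h1 : t₀ ≤ t) (h2 : t ≤ t₀ + ε) : delay t₀ ε t = t₀ := by
  rw [delay, min_eq_right h1, max_eq_left (by linarith)]

lemma delay_of_ge {t₀ ε t : ℝ} (hε : 0 < ε) (ht : t₀ + ε ≤ t) : delay t₀ ε t = t - ε := by
  rw [delay, min_eq_right (by linarith), max_eq_right (by linarith)]

/-- The curve `t ↦ μ_t` frozen at time `t₀` for a duration `ε`, and late by `ε` afterwards. -/
noncomputable def delayKernel (μ : Kernel ℝ Q) (t₀ ε : ℝ) : Kernel ℝ Q :=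
  μ.comap (delay t₀ ε) (continuous_delay t₀ ε).measurable

lemma delayKernel_apply (μ : Kernel ℝ Q) (t₀ ε t : ℝ) :
    delayKernel μ t₀ ε t = μ (delay t₀ ε t) := rfl

instance (μ : Kernel ℝ Q) [IsMarkovKernel μ] (t₀ ε : ℝ) : IsMarkovKernel (delayKernel μ t₀ ε) := by
  unfold delayKernel
  infer_instance

open Classical in
/-- The velocity of the delayed curve: it vanishes while the curve is frozen. -/
noncomputable def delayVelocity (v : ℝ × Q → ℝ) (t₀ ε : ℝ) (z : ℝ × Q) : ℝ :=
  if z.1 ∈ Icc t₀ (t₀ + ε) then 0 else v (delay t₀ ε z.1, z.2)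

lemma measurable_delayVelocity {v : ℝ × Q → ℝ} (hv : Measurable v) (t₀ ε : ℝ) :
    Measurable (delayVelocity v t₀ ε) := by
  refine Measurable.ite (measurable_fst measurableSet_Icc) measurable_const (hv.comp ?_)
  exact ((continuous_delay t₀ ε).measurable.comp measurable_fst).prodMk measurable_snd

lemma setLIntegral_Ioo_add {f : ℝ → ℝ≥0∞} {a b c : ℝ} (hab : a < b) (hbc : b < c) :
    ∫⁻ t in Ioo a c, f t = (∫⁻ t in Ioo a b, f t) + ∫⁻ t in Ioo b c, f t := by
  rw [← Ioc_union_Ioo_eq_Ioo hab.le hbc, lintegral_union measurableSet_Ioo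
    (Set.disjoint_left.2 fun t h1 h2 => absurd h1.2 (not_le.2 h2.1)),
    setLIntegral_congr (Ioo_ae_eq_Ioc (a := a))]

lemma setIntegral_Ioo_add {f : ℝ → ℝ} {a b c : ℝ} (hf : IntegrableOn f (Ioo a c)) (hab : a < b)
    (hbc : b < c) : ∫ t in Ioo a c, f t = (∫ t in Ioo a b, f t) + ∫ t in Ioo b c, f t := by
  rw [← Ioc_union_Ioo_eq_Ioo hab.le hbc] at hf ⊢
  rw [setIntegral_union (Set.disjoint_left.2 fun t h1 h2 => absurd h1.2 (not_le.2 h2.1))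
    measurableSet_Ioo (hf.mono_set subset_union_left) (hf.mono_set subset_union_right),
    integral_Ioc_eq_integral_Ioo]

/-- An integral along the delayed clock: the last `ε` of the time interval is lost, and the frozen
value is gained. No measurability is assumed, as none is known for the number of atoms. -/
lemma setLIntegral_delay {F F' : ℝ → ℝ≥0∞} {c : ℝ≥0∞} {T t₀ ε : ℝ} (ht : -T < t₀) (hε : 0 < ε)
    (htε : t₀ + ε < T) (h1 : ∀ t < t₀, F' t = F t) (h2 : ∀ t ∈ Ioo t₀ (t₀ + ε), F' t = c)
    (h3 : ∀ t > t₀ + ε, F' t = F (t - ε)) :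
    ∫⁻ t in Ioo (-T) T, F' t = (∫⁻ t in Ioo (-T) (T - ε), F t) + c * ENNReal.ofReal ε := by
  have e3 : ∫⁻ t in Ioo (t₀ + ε) T, F (t - ε) = ∫⁻ t in Ioo t₀ (T - ε), F t := by
    have := (measurePreserving_sub_right (volume : Measure ℝ) ε).setLIntegral_comp_preimage_emb
      (MeasurableEquiv.subRight ε).measurableEmbedding F (Ioo t₀ (T - ε))
    simpa [add_comm] using this
  rw [setLIntegral_Ioo_add (b := t₀) ht (by linarith),
    setLIntegral_Ioo_add (a := t₀) (b := t₀ + ε) (by linarith) htε,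
    setLIntegral_congr_fun measurableSet_Ioo (fun t h => h1 t h.2),
    setLIntegral_congr_fun measurableSet_Ioo h2,
    setLIntegral_congr_fun measurableSet_Ioo (fun t h => h3 t h.1), e3,
    setLIntegral_Ioo_add (a := -T) (b := t₀) (c := T - ε) ht (by linarith)]
  simp only [lintegral_const, Measure.restrict_apply MeasurableSet.univ, univ_inter,
    Real.volume_Ioo, add_sub_cancel_left]
  ring

section Delay

variable {T t₀ ε : ℝ} {μ : Kernel ℝ Q}

lemma perimeter_delay (ht : -T < t₀) (hε : 0 < ε) (htε : t₀ + ε < T) :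
    perimeter T (delayKernel μ t₀ ε) =
      (∫⁻ t in Ioo (-T) (T - ε), (({x : Q | μ t {x} ≠ 0}.encard : ℕ∞) : ℝ≥0∞)) +
        (({x : Q | μ t₀ {x} ≠ 0}.encard : ℕ∞) : ℝ≥0∞) * ENNReal.ofReal ε := by
  refine setLIntegral_delay ht hε htε (fun t h => ?_) (fun t h => ?_) (fun t h => ?_)
  · rw [delayKernel_apply, delay_of_le hε h.le]
  · rw [delayKernel_apply, delay_of_mem h.1.le h.2.le]
  · rw [delayKernel_apply, delay_of_ge hε h.le]

/-- A velocity, which is only almost everywhere equal to a Borel function, may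
be replaced by one. -/
lemma IsVelocity.exists_measurable {v : ℝ × Q → ℝ} (hv : IsVelocity T μ v) :
    ∃ w : ℝ × Q → ℝ, Measurable w ∧ IsVelocity T μ w ∧ kinetic T μ w = kinetic T μ v := by
  have hae := hv.integrable.1.ae_eq_mk
  refine ⟨hv.integrable.1.mk v, hv.integrable.1.stronglyMeasurable_mk.measurable,
    ⟨hv.integrable.congr hae, fun ξ hξ => ?_⟩, ?_⟩
  · rw [← hv.continuity_eq ξ hξ]
    refine integral_congr_ae ?_
    filter_upwards [hae] with z hz
    rw [hz]
  · refine lintegral_congr_ae ?_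
    filter_upwards [hae] with z hz
    rw [hz]

variable [IsMarkovKernel μ]

lemma lintegral_delayVelocity {v : ℝ × Q → ℝ} (hv : Measurable v) (ht : -T < t₀) (hε : 0 < ε)
    (htε : t₀ + ε < T) {Φ : ℝ → ℝ≥0∞} (hΦ : Measurable Φ) (hΦ0 : Φ 0 = 0) :
    ∫⁻ z, Φ (delayVelocity v t₀ ε z) ∂(spaceTime T (delayKernel μ t₀ ε)) =
      ∫⁻ t in Ioo (-T) (T - ε), ∫⁻ x, Φ (v (t, x)) ∂(μ t) := by
  unfold spaceTime
  rw [Measure.lintegral_compProd (f := fun z => Φ (delayVelocity v t₀ ε z))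
      (hΦ.comp (measurable_delayVelocity hv t₀ ε)),
    setLIntegral_delay (F := fun t => ∫⁻ x, Φ (v (t, x)) ∂(μ t)) (c := 0) ht hε htε, zero_mul,
    add_zero]
  · intro t h
    simp only [delayVelocity, delayKernel_apply, delay_of_le hε h.le, mem_Icc, not_le.2 h,
      false_and, if_false]
  · intro t h
    simp only [delayVelocity, Ioo_subset_Icc_self h, if_true, hΦ0, lintegral_zero]
  · intro t h
    simp only [delayVelocity, delayKernel_apply, delay_of_ge hε h.le, mem_Icc, not_le.2 h,
      and_false, if_false]

/-- The three pieces of the delayed curve are glued with the trace formula: the traces at the times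
`t₀` and `t₀ + ε` cancel. -/
lemma isVelocity_delay {v : ℝ × Q → ℝ} (hvm : Measurable v) (hv : IsVelocity T μ v)
    (hw : ∀ f : C(Q, ℝ), ContinuousOn (fun t => ∫ x, f x ∂(μ t)) (Icc (-T) T))
    (ht : -T < t₀) (hε : 0 < ε) (htε : t₀ + ε < T) :
    IsVelocity T (delayKernel μ t₀ ε) (delayVelocity v t₀ ε) := by
  have hint : Integrable (delayVelocity v t₀ ε) (spaceTime T (delayKernel μ t₀ ε)) := by
    refine ⟨(measurable_delayVelocity hvm t₀ ε).aestronglyMeasurable, ?_⟩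
    have h1 := lintegral_delayVelocity (μ := μ) hvm ht hε htε measurable_enorm enorm_zero
    rw [HasFiniteIntegral, h1]
    refine lt_of_le_of_lt ?_ hv.integrable.2
    unfold spaceTime
    rw [Measure.lintegral_compProd hvm.enorm]
    exact lintegral_mono_set (Ioo_subset_Ioo_right (by linarith))
  refine ⟨hint, fun ξ hξ => ?_⟩
  have hs : SmoothLift ξ := hξ.smooth
  have hG := integrable_transport hint hs
  rw [integral_spaceTime hG]
  have hF := integrable_slice_integral hG
  rw [setIntegral_Ioo_add (b := t₀) hF ht (by linarith),
    setIntegral_Ioo_add (a := t₀) (b := t₀ + ε)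
      (hF.mono_set (Ioo_subset_Ioo_left ht.le)) (by linarith) htε]
  have e1 : ∫ t in Ioo (-T) t₀, ∫ x, (dTime ξ (t, x) + delayVelocity v t₀ ε (t, x) *
      dSpace ξ (t, x)) ∂(delayKernel μ t₀ ε t) = ∫ x, ξ (t₀, x) ∂(μ t₀) := by
    have h0 : ∫ x, ξ (-T, x) ∂(μ (-T)) = 0 := by simp [hξ.eq_zero (t := -T) (by simp)]
    rw [← sub_zero (∫ x, ξ (t₀, x) ∂(μ t₀)), ← h0,
      ← trace_formula hv hw hs le_rfl ht (by linarith)]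
    refine setIntegral_congr_fun measurableSet_Ioo fun t h => ?_
    simp only [delayVelocity, delayKernel_apply, delay_of_le hε h.2.le, mem_Icc, not_le.2 h.2,
      false_and, if_false]
  have e2 : ∫ t in Ioo t₀ (t₀ + ε), ∫ x, (dTime ξ (t, x) + delayVelocity v t₀ ε (t, x) *
      dSpace ξ (t, x)) ∂(delayKernel μ t₀ ε t) =
        ∫ x, ξ (t₀ + ε, x) ∂(μ t₀) - ∫ x, ξ (t₀, x) ∂(μ t₀) := by
    have h0 := trace_formula (T := T) (μ := Kernel.const ℝ (μ t₀))
      (isVelocity_const (by linarith) _)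
      (fun f => by simpa only [Kernel.const_apply] using continuousOn_const) hs ht.le
      (lt_add_of_pos_right t₀ hε) htε.le
    simp only [Kernel.const_apply] at h0
    rw [← h0]
    refine setIntegral_congr_fun measurableSet_Ioo fun t h => ?_
    simp only [delayVelocity, delayKernel_apply, delay_of_mem h.1.le h.2.le,
      Ioo_subset_Icc_self h, if_true, Pi.zero_apply]
  have e3 : ∫ t in Ioo (t₀ + ε) T, ∫ x, (dTime ξ (t, x) + delayVelocity v t₀ ε (t, x) *
      dSpace ξ (t, x)) ∂(delayKernel μ t₀ ε t) = - ∫ x, ξ (t₀ + ε, x) ∂(μ t₀) := by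
    have h0 : ∫ x, ξ (T - ε + ε, x) ∂(μ (T - ε)) = 0 := by
      simp [hξ.eq_zero (t := T) (by simp)]
    rw [← zero_sub, ← h0, ← trace_formula hv hw (hs.time_shift ε) ht.le (by linarith : t₀ < T - ε)
      (by linarith)]
    have h1 := (measurePreserving_sub_right (volume : Measure ℝ) ε).setIntegral_preimage_emb
      (MeasurableEquiv.subRight ε).measurableEmbedding
      (fun t => ∫ x, (dTime (fun z => ξ (z.1 + ε, z.2)) (t, x) +
        v (t, x) * dSpace (fun z => ξ (z.1 + ε, z.2)) (t, x)) ∂(μ t)) (Ioo t₀ (T - ε))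
    have h2 : (fun t : ℝ => t - ε) ⁻¹' Ioo t₀ (T - ε) = Ioo (t₀ + ε) T := by
      rw [preimage_sub_const_Ioo, sub_add_cancel]
    rw [← h1, h2]
    refine setIntegral_congr_fun measurableSet_Ioo fun t h => ?_
    simp only [hs.dTime_time_shift, SmoothLift.dSpace_time_shift, sub_add_cancel, delayVelocity,
      delayKernel_apply, delay_of_ge hε h.1.le, mem_Icc, not_le.2 h.1, and_false, if_false]
  rw [e1, e2, e3]
  ring

lemma isAdmissible_delay (hμ : IsAdmissible T μ) (ht : -T < t₀) (hε : 0 < ε) (htε : t₀ + ε < T)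
    (hat : ∃ (φ : ℕ → ℝ≥0∞) (X : ℕ → Q),
      μ t₀ = Measure.sum (fun i => φ i • Measure.dirac (X i)))
    (hv : ∃ v, IsVelocity T (delayKernel μ t₀ ε) v) : IsAdmissible T (delayKernel μ t₀ ε) := by
  refine ⟨inferInstance, fun f => ?_, ?_, hv⟩
  · refine (hμ.weakly_continuous f).comp (continuous_delay t₀ ε).continuousOn fun t h => ?_
    rcases le_total t t₀ with h1 | h1
    · rwa [delay_of_le hε h1]
    · rcases le_total t (t₀ + ε) with h2 | h2
      · rw [delay_of_mem h1 h2]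
        constructor <;> linarith
      · rw [delay_of_ge hε h2]
        constructor <;> linarith [h.2]
  · have h0 := (ae_restrict_iff' measurableSet_Ioo).1 hμ.atomic
    have h1 := (measurePreserving_sub_right (volume : Measure ℝ) ε).quasiMeasurePreserving.ae h0
    rw [ae_restrict_iff' measurableSet_Ioo]
    filter_upwards [h0, h1] with t ha hb hmem
    rw [delayKernel_apply]
    rcases le_total t t₀ with h1 | h1
    · rw [delay_of_le hε h1]
      exact ha hmem
    · rcases le_total t (t₀ + ε) with h2 | h2
      · rwa [delay_of_mem h1 h2]
      · rw [delay_of_ge hε h2]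
        exact hb ⟨by linarith, by linarith [hmem.2]⟩

end Delay

/-! ### The change of the terminal cost -/

instance : IsProbabilityMeasure (volume : Measure Q) := ⟨UnitAddCircle.measure_univ⟩

section Terminal

variable {T : ℝ} {μ : Kernel ℝ Q} [IsMarkovKernel μ]

lemma setLIntegral_flux_lt_top {v : ℝ × Q → ℝ} (hvm : Measurable v) (hv : IsVelocity T μ v)
    {a : ℝ} (ha : -T ≤ a) : ∫⁻ t in Ioo a T, ∫⁻ x, ‖v (t, x)‖ₑ ∂(μ t) < ⊤ := by
  refine lt_of_le_of_lt (lintegral_mono_set (Ioo_subset_Ioo_left ha)) ?_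
  have := hv.integrable.2
  unfold HasFiniteIntegral spaceTime at this
  rwa [Measure.lintegral_compProd hvm.enorm] at this

/-- The easy half of the dynamical description of the distance: the flux bounds the change of the
integral of a Lipschitz function. -/
lemma abs_integral_sub_le_flux {v : ℝ × Q → ℝ} (hvm : Measurable v) (hv : IsVelocity T μ v)
    (hw : ∀ f : C(Q, ℝ), ContinuousOn (fun t => ∫ x, f x ∂(μ t)) (Icc (-T) T))
    {a : ℝ} (ha : -T ≤ a) (haT : a < T) {ψ : Q → ℝ} (hψ : ContDiff ℝ ∞ (fun x : ℝ => ψ x))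
    (hlip : LipschitzWith 1 (fun x : ℝ => ψ x)) :
    |∫ x, ψ x ∂(μ T) - ∫ x, ψ x ∂(μ a)| ≤
      (∫⁻ t in Ioo a T, ∫⁻ x, ‖v (t, x)‖ₑ ∂(μ t)).toReal := by
  have hs : SmoothLift fun z : ℝ × Q => ψ z.2 := hψ.comp contDiff_snd
  rw [← trace_formula hv hw hs ha haT le_rfl, ← Real.norm_eq_abs, ← toReal_enorm]
  refine ENNReal.toReal_mono (setLIntegral_flux_lt_top hvm hv ha).ne ?_
  refine (enorm_integral_le_lintegral_enorm _).trans (lintegral_mono fun t => ?_)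
  refine (enorm_integral_le_lintegral_enorm _).trans (lintegral_mono fun x => ?_)
  have h1 : dTime (fun z : ℝ × Q => ψ z.2) (t, x) = 0 := by simp [dTime]
  have h2 : ‖dSpace (fun z : ℝ × Q => ψ z.2) (t, x)‖ ≤ 1 := by
    induction x using QuotientAddGroup.induction_on with | H x => ?_
    have : LipschitzWith 1 (fun s : ℝ => ψ ((x : Q) + (s : Q))) :=
      LipschitzWith.of_dist_le_mul fun s s' => by
        have := hlip.dist_le_mul (x + s) (x + s')
        rwa [dist_add_left] at this
    exact norm_deriv_le_of_lipschitz this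
  rw [h1, zero_add, enorm_mul]
  refine mul_le_of_le_one_right zero_le ?_
  rw [← ofReal_norm]
  exact ENNReal.ofReal_le_one.2 h2

/-- Moving the terminal time from `T` back to `a` costs at most the total flux after `a`. -/
lemma wassersteinSq_le_add_flux {v : ℝ × Q → ℝ} (hvm : Measurable v) (hv : IsVelocity T μ v)
    (hw : ∀ f : C(Q, ℝ), ContinuousOn (fun t => ∫ x, f x ∂(μ t)) (Icc (-T) T))
    {a : ℝ} (ha : -T ≤ a) (haT : a < T) (σ : Measure Q) [IsProbabilityMeasure σ] :
    wassersteinSq (μ a) σ ≤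
      wassersteinSq (μ T) σ + ∫⁻ t in Ioo a T, ∫⁻ x, ‖v (t, x)‖ₑ ∂(μ t) := by
  rw [← ENNReal.ofReal_toReal (setLIntegral_flux_lt_top hvm hv ha).ne]
  refine wassersteinSq_le_add _ _ _ _ fun φ hφ => ?_
  refine le_of_forall_pos_le_add fun δ hδ => ?_
  obtain ⟨ψ, hψ, hlip, hclose⟩ := exists_smooth_approx φ hφ (half_pos hδ)
  have hψc : Continuous ψ :=
    (QuotientAddGroup.isOpenQuotientMap_mk.isQuotientMap.continuous_iff).2 hψ.continuous
  have h1 := (abs_le.1 (abs_integral_sub_le_flux hvm hv hw ha haT hψ hlip)).1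
  have aux : ∀ t, |∫ x, ψ x ∂(μ t) - ∫ x, φ x ∂(μ t)| ≤ δ / 2 := by
    intro t
    have hψi : Integrable ψ (μ t) := continuousMap_integrable _ ⟨ψ, hψc⟩
    rw [← integral_sub hψi (continuousMap_integrable _ φ),
      ← Real.norm_eq_abs]
    refine (norm_integral_le_of_norm_le (integrable_const (δ / 2))
      (Filter.Eventually.of_forall fun x => hclose x)).trans ?_
    simp
  have h2 := abs_le.1 (aux a)
  have h3 := abs_le.1 (aux T)
  linarith [h2.1, h3.2]

lemma mul_enorm_le (Λ : ℝ) (hΛ : 0 ≤ Λ) (r : ℝ) :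
    ENNReal.ofReal Λ * ‖r‖ₑ ≤ ‖r‖ₑ ^ 2 + ENNReal.ofReal (Λ ^ 2 / 4) := by
  rw [← ofReal_norm, ← ENNReal.ofReal_mul hΛ, ← ENNReal.ofReal_pow (norm_nonneg _),
    ← ENNReal.ofReal_add (by positivity) (by positivity)]
  refine ENNReal.ofReal_le_ofReal ?_
  nlinarith [sq_nonneg (‖r‖ - Λ / 2)]

lemma mul_flux_le (Λ : ℝ) (hΛ : 0 ≤ Λ) (v : ℝ × Q → ℝ) {a b : ℝ} :
    ENNReal.ofReal Λ * ∫⁻ t in Ioo a b, ∫⁻ x, ‖v (t, x)‖ₑ ∂(μ t) ≤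
      (∫⁻ t in Ioo a b, ∫⁻ x, ‖v (t, x)‖ₑ ^ 2 ∂(μ t)) +
        ENNReal.ofReal (Λ ^ 2 / 4) * ENNReal.ofReal (b - a) := by
  calc _ = ∫⁻ t in Ioo a b, ∫⁻ x, ENNReal.ofReal Λ * ‖v (t, x)‖ₑ ∂(μ t) := by
        rw [← lintegral_const_mul' _ _ ENNReal.ofReal_ne_top]
        simp only [lintegral_const_mul' _ _ ENNReal.ofReal_ne_top]
    _ ≤ ∫⁻ t in Ioo a b, ∫⁻ x, (‖v (t, x)‖ₑ ^ 2 + ENNReal.ofReal (Λ ^ 2 / 4)) ∂(μ t) :=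
        lintegral_mono fun t => lintegral_mono fun x => mul_enorm_le Λ hΛ _
    _ = _ := by
        simp only [lintegral_add_right _ measurable_const, lintegral_const, measure_univ, mul_one]
        simp

end Terminal

/-! ### Comparison of a minimizer with its delayed curves -/

lemma lintegral_spaceTime_kinetic {T : ℝ} {μ : Kernel ℝ Q} [IsMarkovKernel μ] {v : ℝ × Q → ℝ}
    (hvm : Measurable v) :
    kinetic T μ v = ∫⁻ t in Ioo (-T) T, ∫⁻ x, ‖v (t, x)‖ₑ ^ 2 ∂(μ t) :=
  Measure.lintegral_compProd (hvm.enorm.pow_const 2)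

lemma isAdmissible_const_dirac {T : ℝ} (hT : 0 ≤ T) :
    IsAdmissible T (Kernel.const ℝ (Measure.dirac (0 : Q))) := by
  refine ⟨inferInstance, fun f => ?_, Filter.Eventually.of_forall fun t => ?_,
    0, isVelocity_const hT _⟩
  · simpa only [Kernel.const_apply] using continuousOn_const
  · refine ⟨fun i => if i = 0 then 1 else 0, fun _ => 0, ?_⟩
    ext s hs
    rw [Kernel.const_apply, Measure.sum_apply _ hs, tsum_eq_single 0]
    · simp
    · intro i hi
      simp [hi]

lemma energy_const_dirac_lt_top (Λ T : ℝ) (hT : 0 ≤ T) :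
    energy Λ T (Kernel.const ℝ (Measure.dirac (0 : Q))) < ⊤ := by
  refine ENNReal.add_lt_top.2 ⟨lt_of_le_of_lt (iInf₂_le 0 (isVelocity_const hT _)) ?_,
    ENNReal.mul_lt_top ENNReal.ofReal_lt_top (ENNReal.add_lt_top.2
      ⟨(wassersteinSq_le_one _ _).trans_lt ENNReal.one_lt_top,
        (wassersteinSq_le_one _ _).trans_lt ENNReal.one_lt_top⟩)⟩
  refine ENNReal.add_lt_top.2 ⟨?_, by simp [kinetic]⟩
  have hn : ∀ t : ℝ, {x : Q | Kernel.const ℝ (Measure.dirac (0 : Q)) t {x} ≠ 0}.encard = 1 := by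
    intro t
    rw [encard_eq_one]
    refine ⟨0, ?_⟩
    ext x
    simp [Set.indicator, eq_comm]
  unfold perimeter
  simp only [hn]
  simp

/-- A bound on a mean value is attained, up to one, at some point of a full set. The function need
not be measurable. -/
lemma exists_lt_add_one_of_setLIntegral_le {f : ℝ → ℝ≥0∞} {a b : ℝ} (hab : a < b) {c : ℝ≥0∞}
    (hc : c ≠ ⊤) (hf : ∫⁻ t in Ioo a b, f t ≤ c * ENNReal.ofReal (b - a)) {p : ℝ → Prop}
    (hp : ∀ᵐ t ∂(volume.restrict (Ioo a b)), p t) : ∃ t ∈ Ioo a b, p t ∧ f t < c + 1 := by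
  by_contra! h
  have h1 : ∀ᵐ t ∂(volume.restrict (Ioo a b)), c + 1 ≤ f t := by
    filter_upwards [hp, ae_restrict_mem measurableSet_Ioo] with t ht hm using h t hm ht
  have h2 := (lintegral_mono_ae h1).trans hf
  rw [lintegral_const, Measure.restrict_apply MeasurableSet.univ, univ_inter, Real.volume_Ioo] at h2
  have h3 : ENNReal.ofReal (b - a) ≠ 0 := by simpa using hab
  rw [ENNReal.mul_le_mul_iff_left h3 ENNReal.ofReal_ne_top] at h2
  exact absurd h2 (not_le.2 (ENNReal.lt_add_right hc one_ne_zero))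

/-- The perimeter of a minimizer in `(T - ε, T)` is of order `ε`. The kinetic energy saved by the
delayed curve pays for its larger terminal cost. -/
theorem setLIntegral_card_le {Λ T : ℝ} (hΛ : 0 < Λ) (hT : 0 < T) {μ : Kernel ℝ Q}
    (hmin : IsMinimizer Λ T μ) {t₀ : ℝ} (ht : -T < t₀)
    (hat : ∃ (φ : ℕ → ℝ≥0∞) (X : ℕ → Q),
      μ t₀ = Measure.sum (fun i => φ i • Measure.dirac (X i)))
    {ε : ℝ} (hε : 0 < ε) (htε : t₀ + ε < T) :
    ∫⁻ t in Ioo (T - ε) T, (({x : Q | μ t {x} ≠ 0}.encard : ℕ∞) : ℝ≥0∞) ≤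
      (1 + (({x : Q | μ t₀ {x} ≠ 0}.encard : ℕ∞) : ℝ≥0∞) + ENNReal.ofReal (Λ ^ 2 / 4)) *
        ENNReal.ofReal (T - (T - ε)) := by
  have hμ := hmin.admissible
  have := hμ.prob
  have hfin : energy Λ T μ < ⊤ := (hmin.minimal _ (isAdmissible_const_dirac hT.le)).trans_lt
    (energy_const_dirac_lt_top Λ T hT.le)
  have hI : internalEnergy T μ ≠ ⊤ := (ENNReal.add_lt_top.1 hfin).1.ne
  have hW := (ENNReal.add_lt_top.1 hfin).2.ne
  obtain ⟨v₀, hv₀, hlt₀⟩ : ∃ v, ∃ _ : IsVelocity T μ v,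
      perimeter T μ + kinetic T μ v < internalEnergy T μ + ENNReal.ofReal ε := by
    have : internalEnergy T μ < internalEnergy T μ + ENNReal.ofReal ε :=
      ENNReal.lt_add_right hI (by simpa using hε)
    nth_rewrite 1 [internalEnergy] at this
    simpa only [iInf_lt_iff] using this
  obtain ⟨v, hvm, hv, hkin⟩ := hv₀.exists_measurable
  rw [← hkin] at hlt₀
  have hfin2 : perimeter T μ + kinetic T μ v ≠ ⊤ :=
    (hlt₀.trans (ENNReal.add_lt_top.2 ⟨hI.lt_top, ENNReal.ofReal_lt_top⟩)).ne
  have hv' := isVelocity_delay hvm hv hμ.weakly_continuous ht hε htε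
  have hcomp := hmin.minimal _ (isAdmissible_delay hμ ht hε htε hat ⟨_, hv'⟩)
  have hI' : internalEnergy T (delayKernel μ t₀ ε) ≤
      perimeter T (delayKernel μ t₀ ε) + kinetic T (delayKernel μ t₀ ε) (delayVelocity v t₀ ε) :=
    iInf₂_le _ hv'
  rw [perimeter_delay ht hε htε, show kinetic T (delayKernel μ t₀ ε) (delayVelocity v t₀ ε) = _ from
    lintegral_delayVelocity (Φ := fun r => ‖r‖ₑ ^ 2) hvm ht hε htε (by fun_prop) (by simp)] at hI'
  have hend : delayKernel μ t₀ ε T = μ (T - ε) := by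
    rw [delayKernel_apply, delay_of_ge hε htε.le]
  have hstart : delayKernel μ t₀ ε (-T) = μ (-T) := by
    rw [delayKernel_apply, delay_of_le hε ht.le]
  unfold energy at hcomp
  rw [hend, hstart] at hcomp
  have hterm := wassersteinSq_le_add_flux hvm hv hμ.weakly_continuous (a := T - ε) (by linarith)
    (by linarith) (volume : Measure Q)
  have hflux := mul_flux_le (μ := μ) Λ hΛ.le v (a := T - ε) (b := T)
  rw [sub_sub_cancel] at hflux ⊢
  have hP : perimeter T μ = _ :=
    setLIntegral_Ioo_add (b := T - ε) (by linarith) (by linarith)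
  rw [lintegral_spaceTime_kinetic hvm, setLIntegral_Ioo_add (b := T - ε) (by linarith)
    (by linarith), hP] at hlt₀ hfin2
  set AP := ∫⁻ t in Ioo (-T) (T - ε), (({x : Q | μ t {x} ≠ 0}.encard : ℕ∞) : ℝ≥0∞)
  set BP := ∫⁻ t in Ioo (T - ε) T, (({x : Q | μ t {x} ≠ 0}.encard : ℕ∞) : ℝ≥0∞)
  set AK := ∫⁻ t in Ioo (-T) (T - ε), ∫⁻ x, ‖v (t, x)‖ₑ ^ 2 ∂(μ t)
  set BK := ∫⁻ t in Ioo (T - ε) T, ∫⁻ x, ‖v (t, x)‖ₑ ^ 2 ∂(μ t)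
  set D := ∫⁻ t in Ioo (T - ε) T, ∫⁻ x, ‖v (t, x)‖ₑ ∂(μ t)
  set W := wassersteinSq (μ T) volume
  set W' := wassersteinSq (μ (-T)) volume
  set n := (({x : Q | μ t₀ {x} ≠ 0}.encard : ℕ∞) : ℝ≥0∞)
  set e := ENNReal.ofReal ε
  set l := ENNReal.ofReal Λ
  set q := ENNReal.ofReal (Λ ^ 2 / 4)
  simp only [ENNReal.add_ne_top] at hfin2
  have hS : AP + AK + BK + l * (W + W') ≠ ⊤ := by
    simp only [ENNReal.add_ne_top]
    exact ⟨⟨⟨hfin2.1.1, hfin2.2.1⟩, hfin2.2.2⟩, hW⟩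
  -- `hcomp` compares the energies, `hterm` bounds the new terminal cost, and `hflux` absorbs the
  -- flux `D` into the kinetic energy `BK` that the delayed curve saves.
  refine ENNReal.le_of_add_le_add_left hS ?_
  calc AP + AK + BK + l * (W + W') + BP = (AP + BP + (AK + BK)) + l * (W + W') := by ring
    _ ≤ (internalEnergy T μ + e) + l * (W + W') := by gcongr
    _ = (internalEnergy T μ + l * (W + W')) + e := by ring
    _ ≤ ((AP + n * e + AK) + l * (W + D + W')) + e := by
        refine add_le_add_left (hcomp.trans ?_) e
        gcongr
    _ = (AP + AK + l * (W + W')) + (e + n * e) + l * D := by ring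
    _ ≤ (AP + AK + l * (W + W')) + (e + n * e) + (BK + q * e) := by gcongr
    _ = _ := by ring

/-! ### Weak limits of measures with boundedly many atoms -/

/-- An atomic measure is carried by its atoms; the weights `φ i` of points that are not charged
vanish. -/
lemma measure_compl_atoms_eq_zero {ρ : Measure Q} {φ : ℕ → ℝ≥0∞} {X : ℕ → Q}
    (h : ρ = Measure.sum (fun i => φ i • Measure.dirac (X i))) (hf : {x | ρ {x} ≠ 0}.Finite) :
    ρ {x | ρ {x} ≠ 0}ᶜ = 0 := by
  have hm : MeasurableSet {x | ρ {x} ≠ 0}ᶜ := hf.measurableSet.compl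
  have key : ∀ i, (φ i • Measure.dirac (X i) : Measure Q) {x | ρ {x} ≠ 0}ᶜ = 0 := by
    intro i
    by_cases hi : X i ∈ {x | ρ {x} ≠ 0}ᶜ
    · have h0 : ρ {X i} = 0 := by simpa using hi
      have h1 : (φ i • Measure.dirac (X i) : Measure Q) {X i} ≤ ρ {X i} := by
        conv_rhs => rw [h]
        rw [Measure.sum_apply _ (measurableSet_singleton _)]
        exact ENNReal.le_tsum i
      rw [h0] at h1
      have h2 : φ i = 0 := by simpa using h1
      simp [h2]
    · rw [Measure.smul_apply, Measure.dirac_apply' _ hm, indicator_of_notMem hi, smul_zero]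
  conv_lhs => rw [h]
  rw [Measure.sum_apply _ (by rw [← h]; exact hm)]
  rw [← h]
  simp [key]

/-- If measures carried by at most `M` atoms accumulate weakly at `μ T`, then the support of `μ T`
has at most `M` points, since disjoint neighbourhoods of points of the support are all charged by
the approximating measures. -/
theorem encard_support_le {T : ℝ} (hT : 0 < T) {μ : Kernel ℝ Q} [IsMarkovKernel μ]
    (hw : ∀ f : C(Q, ℝ), ContinuousOn (fun t => ∫ x, f x ∂(μ t)) (Icc (-T) T)) {M : ℕ} {δ₀ : ℝ}
    (hδ₀ : 0 < δ₀)
    (hM : ∀ δ, 0 < δ → δ < δ₀ → ∃ t ∈ Ioo (T - δ) T, μ t {x | μ t {x} ≠ 0}ᶜ = 0 ∧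
      {x : Q | μ t {x} ≠ 0}.encard ≤ M) :
    (μ T).support.encard ≤ M := by
  by_contra hlt
  have hle : ((M + 1 : ℕ) : ℕ∞) ≤ (μ T).support.encard := by
    push_cast
    exact Order.add_one_le_of_lt (not_le.1 hlt)
  obtain ⟨F, hFs, hFc⟩ := exists_subset_encard_eq hle
  have hFf : F.Finite := finite_of_encard_eq_coe hFc
  obtain ⟨U, hU, hdisj⟩ := hFf.t2_separation
  have hf : ∀ x, ∃ f : C(Q, ℝ), EqOn f 0 (U x)ᶜ ∧ EqOn f 1 {x} ∧ ∀ y, f y ∈ Icc (0 : ℝ) 1 :=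
    fun x => exists_continuous_zero_one_of_isClosed (hU x).2.isClosed_compl isClosed_singleton
      (disjoint_singleton_right.2 fun h => h (hU x).1)
  choose f hf0 hf1 hf01 using hf
  have hpos : ∀ x ∈ F, 0 < ∫ y, f x y ∂(μ T) := by
    intro x hx
    rw [integral_pos_iff_support_of_nonneg (fun y => (hf01 x y).1) (continuousMap_integrable _ _)]
    refine (Measure.mem_support_iff_forall _).1 (hFs hx) _ 
      ((f x).continuous.isOpen_support.mem_nhds ?_)
    rw [Function.mem_support, hf1 x rfl]
    exact one_ne_zero
  have hev : ∀ᶠ t in 𝓝[Icc (-T) T] T, ∀ x ∈ F, 0 < ∫ y, f x y ∂(μ t) := by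
    rw [Filter.eventually_all_finite hFf]
    intro x hx
    exact (hw (f x) T ⟨by linarith, le_rfl⟩).eventually (lt_mem_nhds (hpos x hx))
  rw [eventually_nhdsWithin_iff, Metric.eventually_nhds_iff] at hev
  obtain ⟨r, hr, hev⟩ := hev
  obtain ⟨t, ht, h0, hcard⟩ := hM (min (δ₀ / 2) (min r (2 * T)))
    (lt_min (by linarith) (lt_min hr (by linarith))) ((min_le_left _ _).trans_lt (by linarith))
  have hr1 : min (δ₀ / 2) (min r (2 * T)) ≤ r := (min_le_right _ _).trans (min_le_left _ _)
  have hr2 : min (δ₀ / 2) (min r (2 * T)) ≤ 2 * T := (min_le_right _ _).trans (min_le_right _ _)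
  have hpos' : ∀ x ∈ F, 0 < ∫ y, f x y ∂(μ t) := by
    refine hev ?_ ⟨by linarith [ht.1], ht.2.le⟩
    rw [Real.dist_eq, abs_lt]
    constructor <;> linarith [ht.1, ht.2]
  have hex : ∀ x, ∃ a, x ∈ F → a ∈ U x ∧ μ t {a} ≠ 0 := by
    intro x
    by_cases hx : x ∈ F
    · by_contra! hno
      refine (hpos' x hx).ne' (integral_eq_zero_of_ae ?_)
      have : ∀ᵐ y ∂(μ t), y ∈ {x | μ t {x} ≠ 0} := h0
      filter_upwards [this] with y hy
      exact hf0 x fun hyU => hy ((hno y).2 hyU)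
    · exact ⟨x, fun h => absurd h hx⟩
  choose a ha using hex
  have hinj : InjOn a F := by
    intro x hx y hy hxy
    by_contra hne
    exact Set.disjoint_left.1 (hdisj hx hy hne) (ha x hx).1 (hxy ▸ (ha y hy).1)
  have h1 := encard_le_encard_of_injOn (t := {x : Q | μ t {x} ≠ 0}) (fun x hx => (ha x hx).2) hinj
  rw [hFc] at h1
  exact absurd (Nat.cast_le.1 (h1.trans hcard)) (by omega)

lemma exists_sum_dirac_of_finite_support (ρ : Measure Q) [IsProbabilityMeasure ρ]
    (hf : ρ.support.Finite) :
    ∃ (N : ℕ) (X : Fin N → Q) (φ : Fin N → ℝ), Function.Injective X ∧ (∀ i, 0 < φ i) ∧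
      ∑ i, φ i = 1 ∧ ρ = ∑ i, ENNReal.ofReal (φ i) • Measure.dirac (X i) := by
  let e := hf.toFinset.equivFin.symm
  have hpos : ∀ x ∈ ρ.support, 0 < ρ {x} := by
    intro x hx
    have hopen : IsOpen (ρ.support \ {x})ᶜ := (hf.subset sdiff_subset).isClosed.isOpen_compl
    have h1 := (Measure.mem_support_iff_forall _).1 hx _ (hopen.mem_nhds (by simp))
    have h2 : (ρ.support \ {x})ᶜ ⊆ {x} ∪ ρ.supportᶜ := by
      intro y hy
      by_cases h : y = x
      · exact Or.inl h
      · exact Or.inr fun h' => hy ⟨h', h⟩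
    have h3 := (measure_mono h2).trans (measure_union_le (μ := ρ) _ _)
    rw [Measure.measure_compl_support, add_zero] at h3
    exact h1.trans_le h3
  have hsum : ρ = ∑ i, ENNReal.ofReal (ρ {(e i : Q)}).toReal • Measure.dirac (e i : Q) := by
    have h1 : ρ.restrict (⋃ x ∈ hf.toFinset, {x}) = ρ := by
      refine Measure.restrict_eq_self_of_ae_mem ?_
      filter_upwards [Measure.support_mem_ae (μ := ρ)] with x hx
      simpa using hx
    have h2 := Measure.restrict_biUnion_finset (μ := ρ) (T := hf.toFinset) (s := fun x => {x})
      (fun x _ y _ hxy => by simpa [Function.onFun] using hxy) (fun x => measurableSet_singleton x)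
    rw [h1, Measure.sum_fintype] at h2
    conv_lhs => rw [h2]
    rw [← Equiv.sum_comp e]
    simp only [Measure.restrict_singleton, ENNReal.ofReal_toReal (measure_ne_top ρ _)]
  refine ⟨_, fun i => (e i : Q), fun i => (ρ {(e i : Q)}).toReal,
    Subtype.val_injective.comp e.injective, fun i => ?_, ?_, hsum⟩
  · exact ENNReal.toReal_pos (hpos _ (hf.mem_toFinset.1 (e i).2)).ne' (measure_ne_top _ _)
  · have h1 : ρ univ = 1 := measure_univ
    rw [hsum, Measure.finsetSum_apply] at h1
    simp only [Measure.smul_apply, measure_univ, smul_eq_mul, mul_one] at h1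
    rw [← ENNReal.ofReal_sum_of_nonneg (fun i _ => ENNReal.toReal_nonneg)] at h1
    exact ENNReal.ofReal_eq_one.1 h1

end ToyModel

theorem theorem1p5 (Λ T : ℝ) (hΛ : 0 < Λ) (hT : 0 < T)
    (μ : ProbabilityTheory.Kernel ℝ ToyModel.Q)
    (hmin : ToyModel.IsMinimizer Λ T μ) (hsymm : ToyModel.IsSymmetric T μ) :
    ∃ (N : ℕ) (X : Fin N → ToyModel.Q) (φ : Fin N → ℝ),
      Function.Injective X ∧ (∀ i, 0 < φ i) ∧ ∑ i, φ i = 1 ∧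
        μ T = ∑ i, ENNReal.ofReal (φ i) • MeasureTheory.Measure.dirac (X i) := by
  open ToyModel in
  have hμ := hmin.admissible
  have := hμ.prob
  have hfin : energy Λ T μ < ⊤ := (hmin.minimal _ (isAdmissible_const_dirac hT.le)).trans_lt
    (energy_const_dirac_lt_top Λ T hT.le)
  have hP : perimeter T μ ≠ ⊤ := by
    have hI : internalEnergy T μ < ⊤ := (ENNReal.add_lt_top.1 hfin).1
    simp only [internalEnergy, iInf_lt_iff] at hI
    obtain ⟨v, _, hv⟩ := hI
    exact (ENNReal.add_lt_top.1 hv).1.ne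
  have hT0 : ENNReal.ofReal (T - -T) ≠ 0 := by
    rw [Ne, ENNReal.ofReal_eq_zero, not_le]
    linarith
  -- The number of atoms has a finite integral, so the curve may be frozen at a time `t₀` at which
  -- there are finitely many.
  obtain ⟨t₀, ht₀, hat₀, hlt₀⟩ := exists_lt_add_one_of_setLIntegral_le (a := -T) (b := T)
    (c := perimeter T μ / ENNReal.ofReal (T - -T)) (by linarith) (ENNReal.div_ne_top hP hT0)
    (f := fun t => (({x : Q | μ t {x} ≠ 0}.encard : ℕ∞) : ℝ≥0∞))
    (by rw [ENNReal.div_mul_cancel hT0 ENNReal.ofReal_ne_top]; exact le_rfl) hμ.atomic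
  set c : ℝ≥0∞ := 1 + (({x : Q | μ t₀ {x} ≠ 0}.encard : ℕ∞) : ℝ≥0∞) +
    ENNReal.ofReal (Λ ^ 2 / 4) with hc
  have hctop : c ≠ ⊤ := by
    simp only [hc, ENNReal.add_ne_top]
    exact ⟨⟨ENNReal.one_ne_top, hlt₀.ne_top⟩, ENNReal.ofReal_ne_top⟩
  obtain ⟨M, hM⟩ := ENNReal.exists_nat_gt (ENNReal.add_ne_top.2 ⟨hctop, ENNReal.one_ne_top⟩)
  have hsupp : (μ T).support.encard ≤ M := by
    refine encard_support_le hT hμ.weakly_continuous (sub_pos.2 ht₀.2) fun δ hδ hδ' => ?_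
    have hae : ∀ᵐ t ∂(volume.restrict (Ioo (T - δ) T)), ∃ (φ : ℕ → ℝ≥0∞) (X : ℕ → Q),
        μ t = Measure.sum (fun i => φ i • Measure.dirac (X i)) :=
      ae_mono (Measure.restrict_mono (Ioo_subset_Ioo_left (by linarith [ht₀.1])) le_rfl) hμ.atomic
    obtain ⟨t, ht, ⟨φ, X, hφX⟩, hlt⟩ := exists_lt_add_one_of_setLIntegral_le (by linarith) hctop
      (setLIntegral_card_le hΛ hT hmin ht₀.1 hat₀ hδ (by linarith)) hae
    have hcard : {x : Q | μ t {x} ≠ 0}.encard ≤ M := by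
      have := (hlt.trans hM).le
      rwa [← ENat.toENNReal_coe, ENat.toENNReal_le] at this
    exact ⟨t, ht, measure_compl_atoms_eq_zero hφX (finite_of_encard_le_coe hcard), hcard⟩
  exact exists_sum_dirac_of_finite_support _ (finite_of_encard_le_coe hsupp)
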